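/- Let $G=H\rtimes\mathbb{Z}^n$ be an internal semidirect product ($H$ normal, $x^y:=y^{-1}xy$). A character is a homomorphism to $\mathbb{R}$; it is discrete if its image is cyclic. For a character $\rho:\mathbb{Z}^n\to\mathbb{R}$, a subset $Q\subseteq H$ is $\rho$-confining if $Q=Q^{-1}$; $Q^z\subseteq Q$ whenever $\rho(z)\ge 0$; for every $h\in H$ some $z\in\mathbb{Z}^n$ satisfies $h^z\in Q$; and $(Q\cdot Q)^{z_0}\subseteq Q$ for some $z_0\in\mathbb{Z}^n$. It is strictly $\rho$-confining if moreover $Q^z\subsetneq Q$ for some $z\in\mathbb{Z}^n$. Let $Z_\rho=\{z\in\mathbb{Z}^n : |\rho(z)|\le C_\rho\}$, where $C_\rho>0$ is any value of $\rho$ that bounds $|\rho|$ on some finite generating set of $\mathbb{Z}^n$. A hyperbolic structure $[A]$ on $G$ is given by a generating set $A$ with $\mathrm{Cay}(G,A)$ hyperbolic, and it is represented by a cobounded hyperbolic action $G\curvearrowright X$ if $G\curvearrowright \mathrm{Cay}(G,A)$ and $G\curvearrowright X$ are equivalent, i.e. there are coarsely Lipschitz, coarsely $G$-equivariant maps in both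 directions. (1) Let $\rho:\mathbb{Z}^n\to\mathbb{R}$ be a non-trivial discrete character and let $Q$ be a $\rho$-confining subset that is a subgroup. Then there are elements $a\in\mathbb{Z}^n$ with $\rho(a)$ positive and minimal, $K=Q\ker(\rho)$ is a subgroup of $G$, and for each such $a$ the group $G$ is an ascending HNN-extension with base $K$ and stable letter $a$. Moreover $[Q\cup Z_\rho]$ is a hyperbolic structure, and it is represented by the (simplicial) action of $G$ on the Bass--Serre tree of this HNN-extension. (2) Let $G$ act simplicially and coboundedly on a simplicial tree $X$, and suppose that the action is oriented lineal (exactly two limit points, both fixed by $G$) or quasi-parabolic (infinitely many limit points, and a fixed point in $\partial X$). Let $\xi\in\partial X$ be fixed by $G$ and let $p:G\to\mathbb{R}$ be the corresponding Busemann pseudocharacter, that is, the homogenization $p(g)=\lim_k q(g^k)/k$ of $q(g)=\limsup_m\,(d(x,x_m)-d(gx,x_m))$, where $x\in X$ and $x_m\to\xi$. Suppose that $p$ vanishes on $H$. Then $p$ induces a non-trivial character $\rho:\mathbb{Z}^n\to\mathbb{R}$, $p(hz)=\rho(z)$ for $h\in H$, $z\in\mathbb{Z}^n$, and $\rho$ is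 discrete. Moreover there is a vertex $w$ of $X$ such that the subgroup $Q=\mathrm{Stab}_H(w)$ is $\rho$-confining, $[Q\cup Z_\rho]$ is a hyperbolic structure represented by $G\curvearrowright X$, and $X$ is $G$-equivariantly quasi-isometric to $\mathrm{Cay}(G,Q\cup Z_\rho)$. If the action is oriented lineal, then $Q=H$; if it is quasi-parabolic, then $Q$ is strictly confining. -/

import Mathlib

open Filter Topology
open scoped Pointwise

namespace ConfTree

universe u v w

/-! ### Graphs as metric spaces, and actions on them

A connected graph is regarded as a metric space through its path metric `Γ.dist` on the vertex
set, which is `1/2`-dense in the geometric realization and invariant under all simplicial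
automorphisms. A simplicial action of `G` is a homomorphism from `G` to the group `Γ ≃g Γ` of
graph automorphisms. -/

/-- The Gromov product `(x | y)_o` in the path metric. -/
noncomputable def gromovProduct {V : Type v} (Γ : SimpleGraph V) (o x y : V) : ℝ :=
  ((Γ.dist o x : ℝ) + Γ.dist o y - Γ.dist x y) / 2

/-- Gromov hyperbolicity (four-point condition). -/
def IsHyperbolic {V : Type v} (Γ : SimpleGraph V) : Prop :=
  ∃ δ : ℝ, ∀ o x y z : V,
    min (gromovProduct Γ o x y) (gromovProduct Γ o y z) - δ ≤ gromovProduct Γ o x z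

/-- The sequences `x` and `y` converge to infinity together: `(x_i | y_j)_o → ∞` as `i, j → ∞`
(the choice of the base point `o` is irrelevant). -/
def CoConverge {V : Type v} (Γ : SimpleGraph V) (x y : ℕ → V) : Prop :=
  ∀ o : V, Tendsto (fun p : ℕ × ℕ => gromovProduct Γ o (x p.1) (y p.2)) atTop atTop

/-- The sequences that converge to a point at infinity. -/
def GromovSeq {V : Type v} (Γ : SimpleGraph V) : Type v :=
  {x : ℕ → V // CoConverge Γ x x}

/-- The (sequential) Gromov boundary. On a hyperbolic graph the relation of which the quotient is
taken is already an equivalence relation. -/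
def Boundary {V : Type v} (Γ : SimpleGraph V) : Type v :=
  Quot (fun x y : GromovSeq Γ => CoConverge Γ x.1 y.1)

/-- The sequence `x` of vertices converges to the boundary point `ξ`. -/
def ConvergesTo {V : Type v} {Γ : SimpleGraph V} (x : ℕ → V) (ξ : Boundary Γ) : Prop :=
  ∃ hx : CoConverge Γ x x, (Quot.mk _ (⟨x, hx⟩ : GromovSeq Γ) : Boundary Γ) = ξ

theorem dist_iso {V : Type v} {Γ : SimpleGraph V} (e : Γ ≃g Γ) (x y : V) :
    Γ.dist (e x) (e y) = Γ.dist x y := by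
  have key : ∀ (f : Γ ≃g Γ) (a b : V), Γ.dist (f a) (f b) ≤ Γ.dist a b := by
    intro f a b
    by_cases h : Γ.Reachable a b
    · obtain ⟨p, hp⟩ := h.exists_walk_length_eq_dist
      rw [← hp]
      exact (SimpleGraph.dist_le (p.map f.toHom)).trans (by simp)
    · have h2 : ¬ Γ.Reachable (f a) (f b) := by
        intro h3
        apply h
        have h4 := h3.map f.symm.toHom
        simpa using h4
      rw [SimpleGraph.dist_eq_zero_of_not_reachable h2]
      exact Nat.zero_le _
  refine le_antisymm (key e x y) ?_
  simpa using key e.symm (e x) (e y)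

theorem CoConverge.map {V : Type v} {Γ : SimpleGraph V} (e : Γ ≃g Γ) {x y : ℕ → V}
    (h : CoConverge Γ x y) : CoConverge Γ (fun n => e (x n)) (fun n => e (y n)) := by
  intro o
  have h1 := h (e.symm o)
  refine h1.congr ?_
  intro p
  have h2 : e (e.symm o) = o := e.apply_symm_apply o
  have h3 : ∀ a, Γ.dist o (e a) = Γ.dist (e.symm o) a := by
    intro a
    conv_lhs => rw [← h2]
    exact dist_iso e _ _
  simp only [gromovProduct, h3, dist_iso]

/-- The map induced on the boundary by an automorphism. -/
def boundaryMap {V : Type v} {Γ : SimpleGraph V} (e : Γ ≃g Γ) : Boundary Γ → Boundary Γ :=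
  Quot.map (fun x => ⟨fun n => e (x.1 n), x.2.map e⟩) (fun _ _ h => h.map e)

/-- `G` fixes the boundary point `ξ`. -/
def FixesPoint {G : Type u} [Group G] {V : Type v} {Γ : SimpleGraph V} (α : G →* (Γ ≃g Γ))
    (ξ : Boundary Γ) : Prop :=
  ∀ g : G, boundaryMap (α g) ξ = ξ

/-- The limit set `Λ(G)`: all boundary points that are limits of sequences in an orbit. -/
def limitSet {G : Type u} [Group G] {V : Type v} {Γ : SimpleGraph V} (α : G →* (Γ ≃g Γ)) :
    Set (Boundary Γ) :=
  {ξ | ∃ (x : V) (g : ℕ → G), ConvergesTo (fun n => α (g n) x) ξ}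

/-- Oriented lineal: there are exactly two limit points, and both are fixed. -/
def IsOrientedLineal {G : Type u} [Group G] {V : Type v} {Γ : SimpleGraph V}
    (α : G →* (Γ ≃g Γ)) : Prop :=
  (limitSet α).encard = 2 ∧ ∀ ξ ∈ limitSet α, FixesPoint α ξ

/-- Quasi-parabolic: there are infinitely many limit points, and some boundary point is fixed. -/
def IsQuasiParabolic {G : Type u} [Group G] {V : Type v} {Γ : SimpleGraph V}
    (α : G →* (Γ ≃g Γ)) : Prop :=
  (limitSet α).Infinite ∧ ∃ ξ : Boundary Γ, FixesPoint α ξ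

/-- Cobounded: some bounded set meets every orbit. -/
def IsCobounded {G : Type u} [Group G] {V : Type v} {Γ : SimpleGraph V}
    (α : G →* (Γ ≃g Γ)) : Prop :=
  ∃ (x : V) (R : ℕ), ∀ y : V, ∃ g : G, Γ.dist (α g x) y ≤ R

/-! ### The Busemann pseudocharacter -/

/-- The Busemann quasimorphism `g ↦ limsup (d(x, xₙ) - d(gx, xₙ))`. -/
noncomputable def busemannQuasimorphism {G : Type u} [Group G] {V : Type v} {Γ : SimpleGraph V}
    (α : G →* (Γ ≃g Γ)) (x : V) (xs : ℕ → V) (g : G) : ℝ :=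
  limsup (fun n : ℕ => (Γ.dist x (xs n) : ℝ) - Γ.dist (α g x) (xs n)) atTop

/-- The homogenization `g ↦ lim q(gⁿ)/n` of a quasimorphism `q`. -/
noncomputable def homogenization {G : Type u} [Group G] (q : G → ℝ) (g : G) : ℝ :=
  limUnder atTop (fun n : ℕ => q (g ^ n) / n)

/-- The Busemann pseudocharacter at the boundary point to which `xs` converges. -/
noncomputable def busemann {G : Type u} [Group G] {V : Type v} {Γ : SimpleGraph V}
    (α : G →* (Γ ≃g Γ)) (x : V) (xs : ℕ → V) : G → ℝ :=
  homogenization (busemannQuasimorphism α x xs)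

/-! ### The order on hyperbolic actions, and hyperbolic structures -/

/-- `f` is coarsely Lipschitz. -/
def IsCoarselyLipschitz {V : Type v} {W : Type w} (Γ : SimpleGraph V) (Δ : SimpleGraph W)
    (f : V → W) : Prop :=
  ∃ L : ℝ, ∀ x y : V, (Δ.dist (f x) (f y) : ℝ) ≤ L * Γ.dist x y + L

/-- `f` is coarsely `G`-equivariant. -/
def IsCoarselyEquivariant {G : Type u} [Group G] {V : Type v} {W : Type w} {Γ : SimpleGraph V}
    {Δ : SimpleGraph W} (α : G →* (Γ ≃g Γ)) (β : G →* (Δ ≃g Δ)) (f : V → W) : Prop :=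
  ∀ x : V, ∃ C : ℝ, ∀ g : G, (Δ.dist (f (α g x)) (β g (f x)) : ℝ) ≤ C

/-- `β` is dominated by `α`. -/
def IsDominatedBy {G : Type u} [Group G] {V : Type v} {W : Type w} {Γ : SimpleGraph V}
    {Δ : SimpleGraph W} (β : G →* (Δ ≃g Δ)) (α : G →* (Γ ≃g Γ)) : Prop :=
  ∃ f : V → W, IsCoarselyLipschitz Γ Δ f ∧ IsCoarselyEquivariant α β f

/-- Equivalence of actions: each dominates the other. -/
def IsEquivalent {G : Type u} [Group G] {V : Type v} {W : Type w} {Γ : SimpleGraph V}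
    {Δ : SimpleGraph W} (α : G →* (Γ ≃g Γ)) (β : G →* (Δ ≃g Δ)) : Prop :=
  IsDominatedBy α β ∧ IsDominatedBy β α

/-- There is a `G`-equivariant quasi-isometry. -/
def IsEquivariantlyQuasiIsometric {G : Type u} [Group G] {V : Type v} {W : Type w}
    {Γ : SimpleGraph V} {Δ : SimpleGraph W} (α : G →* (Γ ≃g Γ)) (β : G →* (Δ ≃g Δ)) : Prop :=
  ∃ f : V → W, (∀ (g : G) (x : V), f (α g x) = β g (f x)) ∧
    ∃ L : ℝ, 1 ≤ L ∧
      (∀ x y : V, (Δ.dist (f x) (f y) : ℝ) ≤ L * Γ.dist x y + L) ∧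
      (∀ x y : V, (Γ.dist x y : ℝ) / L - L ≤ Δ.dist (f x) (f y)) ∧
      ∀ y : W, ∃ x : V, (Δ.dist (f x) y : ℝ) ≤ L

/-- The action of `G` by left multiplication on its Cayley graph with respect to `A`. -/
def cayleyAction {G : Type u} [Group G] (A : Set G) :
    G →* (SimpleGraph.mulCayley A ≃g SimpleGraph.mulCayley A) where
  toFun g := ⟨Equiv.mulLeft g, by intro a b; simp [SimpleGraph.mulCayley_adj', mul_assoc]⟩
  map_one' := by ext x; simp
  map_mul' g h := by ext x; simp

/-- `[A]` is a hyperbolic structure: `A` generates `G` and `Cay(G, A)` is hyperbolic. -/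
def IsHyperbolicStructure {G : Type u} [Group G] (A : Set G) : Prop :=
  Subgroup.closure A = ⊤ ∧ IsHyperbolic (SimpleGraph.mulCayley A)

/-- The hyperbolic structure `[A]` is represented by the cobounded hyperbolic action `α`:
the actions on `Cay(G, A)` and on `Γ` are equivalent. -/
def IsRepresentedBy {G : Type u} [Group G] {V : Type v} {Γ : SimpleGraph V} (A : Set G)
    (α : G →* (Γ ≃g Γ)) : Prop :=
  IsHyperbolicStructure A ∧ Γ.Connected ∧ IsHyperbolic Γ ∧ IsCobounded α ∧
    IsEquivalent (cayleyAction A) α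

/-! ### Characters and confining subsets of `G = H ⋊ ℤⁿ`

The semidirect product is internal: `H` is a normal subgroup of `G`, and `Z` is a complement of
`H`, isomorphic to `ℤⁿ`. A character of `Z` is a homomorphism `ρ : Z →* Multiplicative ℝ`, and
`(ρ z).toAdd` is its real value at `z`. -/

/-- A character is discrete if its image is cyclic. -/
def IsDiscrete {K : Type u} [Group K] (ρ : K →* Multiplicative ℝ) : Prop :=
  IsCyclic ρ.range

/-- The kernel of `ρ`, as a subgroup of `G`. -/
def kerIn {G : Type u} [Group G] {Z : Subgroup G} (ρ : Z →* Multiplicative ℝ) : Subgroup G :=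
  ρ.ker.map Z.subtype

/-- `Q` is a `ρ`-confining subset of `H`; here `q ^ z` is `z⁻¹ q z`. -/
structure IsConfining {G : Type u} [Group G] (H Z : Subgroup G) (ρ : Z →* Multiplicative ℝ)
    (Q : Set G) : Prop where
  subset : Q ⊆ H
  symmetric : ∀ q ∈ Q, q⁻¹ ∈ Q
  stays : ∀ z : Z, 0 ≤ (ρ z).toAdd → ∀ q ∈ Q, (z : G)⁻¹ * q * z ∈ Q
  gets_in : ∀ h ∈ H, ∃ z : Z, (z : G)⁻¹ * h * z ∈ Q
  products : ∃ z : Z, ∀ q ∈ Q, ∀ r ∈ Q, (z : G)⁻¹ * (q * r) * z ∈ Q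

/-- `Q` is strictly `ρ`-confining: moreover `Q ^ z` is properly contained in `Q` for some `z`. -/
def IsStrictlyConfining {G : Type u} [Group G] (H Z : Subgroup G) (ρ : Z →* Multiplicative ℝ)
    (Q : Set G) : Prop :=
  IsConfining H Z ρ Q ∧ ∃ z : Z, (fun q => (z : G)⁻¹ * q * z) '' Q ⊂ Q

/-- The constants `C_ρ` allowed in the construction of `Z_ρ`: positive values of `ρ` that bound
`|ρ|` on some finite generating set of `Z`. -/
def IsAdmissible {G : Type u} [Group G] {Z : Subgroup G} (ρ : Z →* Multiplicative ℝ) (C : ℝ) :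
    Prop :=
  0 < C ∧ (∃ S : Set Z, S.Finite ∧ Subgroup.closure S = ⊤ ∧ ∀ s ∈ S, |(ρ s).toAdd| ≤ C) ∧
    ∃ z : Z, (ρ z).toAdd = C

/-- The set `Z_ρ = {z ∈ ℤⁿ | |ρ(z)| ≤ C}`. -/
def slab {G : Type u} [Group G] {Z : Subgroup G} (ρ : Z →* Multiplicative ℝ) (C : ℝ) : Set G :=
  {g | ∃ z : Z, (z : G) = g ∧ |(ρ z).toAdd| ≤ C}

/-- `ρ(a)` is positive and minimal among the positive values of `ρ`. -/
def IsMinimalPositive {G : Type u} [Group G] {Z : Subgroup G} (ρ : Z →* Multiplicative ℝ)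
    (a : Z) : Prop :=
  0 < (ρ a).toAdd ∧ ∀ z : Z, 0 < (ρ z).toAdd → (ρ a).toAdd ≤ (ρ z).toAdd

/-! ### Ascending HNN-extensions and their Bass–Serre trees -/

/-- `G` is the ascending HNN-extension with base `K` and stable letter `a`: it has the presentation
`⟨K, t | t x t⁻¹ = φ x for x ∈ A⟩`, with `t` equal to `a`, where `A` is a subgroup of `K` and
`φ : A → K` is an isomorphism onto `K`. Thus `A = a⁻¹ K a ≤ K`. -/
def IsAscendingHNN {G : Type u} [Group G] (K : Subgroup G) (a : G) : Prop :=
  ∃ (A : Subgroup K) (φ : A ≃* (⊤ : Subgroup K)) (Φ : HNNExtension K A ⊤ φ ≃* G),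
    (∀ k : K, Φ (HNNExtension.of k) = k) ∧ Φ HNNExtension.t = a

/-- The Bass–Serre tree of an HNN-extension with base `K` and stable letter `a`: the vertices are
the cosets `gK`, and there is an edge from `gK` to `gaK` for every `g`. -/
def bassSerre {G : Type u} [Group G] (K : Subgroup G) (a : G) : SimpleGraph (G ⧸ K) :=
  SimpleGraph.fromRel (fun x y => ∃ g : G, x = (g : G ⧸ K) ∧ y = ((g * a : G) : G ⧸ K))

theorem bassSerre_rel_smul {G : Type u} [Group G] (K : Subgroup G) (a g : G) (x y : G ⧸ K) :
    (∃ k : G, g • x = (k : G ⧸ K) ∧ g • y = ((k * a : G) : G ⧸ K)) ↔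
      ∃ k : G, x = (k : G ⧸ K) ∧ y = ((k * a : G) : G ⧸ K) := by
  constructor
  · rintro ⟨k, h1, h2⟩
    refine ⟨g⁻¹ * k, ?_, ?_⟩
    · rw [eq_comm, ← inv_smul_eq_iff.mpr h1.symm]; rfl
    · rw [eq_comm, ← inv_smul_eq_iff.mpr h2.symm, mul_assoc]; rfl
  · rintro ⟨k, rfl, rfl⟩
    exact ⟨g * k, rfl, by rw [mul_assoc]; rfl⟩

/-- The action of `G` on the Bass–Serre tree by left multiplication. -/
def bassSerreAction {G : Type u} [Group G] (K : Subgroup G) (a : G) :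
    G →* (bassSerre K a ≃g bassSerre K a) where
  toFun g := ⟨MulAction.toPerm g, by
    intro x y
    simp only [bassSerre, SimpleGraph.fromRel_adj, MulAction.toPerm_apply, ne_eq,
      smul_left_cancel_iff, bassSerre_rel_smul]⟩
  map_one' := by ext x; exact one_smul G x
  map_mul' g h := by ext x; exact mul_smul g h x

/-- The stabilizer in `H` of the vertex `x`. -/
def vertexStabilizer {G : Type u} [Group G] {V : Type v} {Γ : SimpleGraph V}
    (α : G →* (Γ ≃g Γ)) (H : Subgroup G) (x : V) : Subgroup G where
  carrier := {g | g ∈ H ∧ α g x = x}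
  one_mem' := ⟨H.one_mem, by simp⟩
  mul_mem' := by
    rintro g h ⟨hg, hg'⟩ ⟨hh, hh'⟩
    refine ⟨H.mul_mem hg hh, ?_⟩
    rw [map_mul, RelIso.mul_apply, hh', hg']
  inv_mem' := by
    rintro g ⟨hg, hg'⟩
    refine ⟨H.inv_mem hg, ?_⟩
    have h : α g⁻¹ (α g x) = x := by
      rw [← RelIso.mul_apply, ← map_mul, inv_mul_cancel, map_one, RelIso.one_apply]
    rwa [hg'] at h

end ConfTree

open ConfTree

/-!
Rooting a tree at an end `ξ` turns it into a parent function `P` (one step towards `ξ`) together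
with a height `ht` (the Busemann function), such that any two vertices have a common ancestor. A
group that fixes `ξ` commutes with `P` and shifts `ht` by a character `χ` with integer values,
which is the Busemann pseudocharacter; this is why `ρ` is discrete.

Both halves of the theorem rest on one computation. Let `w` be a vertex whose translates by `Z` run
along the ray from `w` to `ξ`, that is, `z w = P^k w` when `χ z = k ≥ 0`. Then `d(w, g w)` is the
least `i + j` with `P^i (g w) = P^j w`, and if `χ z' = i` and `χ z = j` then `z⁻¹ g z'` fixes `w`.
Hence the word metric of `Stab_H(w) ∪ Z_ρ` is roughly similar to the orbit metric of `w`.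

* For confining `Q`, conjugation by `a` maps `K = Q ker ρ` into itself and every element of `G` lies
  in some `a^i K a^-j`. So `G` is an ascending HNN-extension, `gK ↦ gaK` is a parent function on its
  Bass–Serre tree, and `w` is the coset `K`, with `Stab_H(w) = Q`.
* For an action on a tree, an element `b` of `Z` with `χ b > 0` eventually pushes every vertex onto
  its axis. As `Z` is commutative, a vertex of the axis of `b` serves as `w`.

If `Stab_H(w)` is confining but not strictly so, it equals `H`, every orbit stays close to one
line, and the limit set is finite. In the oriented lineal case the second fixed end gives a second
parent function, which leads back from the ray to `w`; as every `h` in `H` fixes the vertices far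
along the ray, it fixes `w`.
-/

namespace ConfTree

/-! ### Graphs rooted at an end -/

section ParentFunction

variable {V : Type*} {Γ : SimpleGraph V} {P : V → V}

theorem exists_walk_iterate (hP : ∀ v, Γ.Adj v (P v)) (k : ℕ) (v : V) :
    ∃ p : Γ.Walk v (P^[k] v), p.length = k := by
  induction k generalizing v with
  | zero => exact ⟨.nil, rfl⟩
  | succ k ih =>
    obtain ⟨p, hp⟩ := ih (P v)
    exact ⟨.cons (hP v) p, by simp [hp]⟩

theorem exists_walk_of_iterate_eq (hP : ∀ v, Γ.Adj v (P v)) {u v : V} {i j : ℕ}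
    (huv : P^[i] u = P^[j] v) : ∃ p : Γ.Walk u v, p.length = i + j := by
  obtain ⟨p, hp⟩ := exists_walk_iterate hP i u
  obtain ⟨q, hq⟩ := exists_walk_iterate hP j v
  exact ⟨p.append (q.copy rfl huv.symm).reverse, by simp [hp, hq]⟩

theorem exists_iterate_eq_of_walk (hP : ∀ u v, Γ.Adj u v → P u = v ∨ P v = u) {u v : V}
    (p : Γ.Walk u v) : ∃ i j : ℕ, P^[i] u = P^[j] v ∧ i + j ≤ p.length := by
  induction p with
  | nil => exact ⟨0, 0, rfl, le_rfl⟩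
  | @cons u v w huv p ih =>
    obtain ⟨i, j, hij, hle⟩ := ih
    rw [SimpleGraph.Walk.length_cons]
    rcases hP u v huv with rfl | rfl
    · exact ⟨i + 1, j, hij, by lia⟩
    · rcases i with _ | i
      · refine ⟨0, j + 1, ?_, by lia⟩
        rw [Function.iterate_succ_apply', ← hij]
        rfl
      · exact ⟨i, j, hij, by lia⟩

end ParentFunction

/-- `Γ` is the graph of the parent function `P`, along which the height `ht` increases by one, and
any two vertices have a common ancestor. Thus `Γ` is a tree with a distinguished end, towards which
`P` moves every vertex; `ht` is minus the Busemann function of that end. -/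
structure IsRootedAtEnd {V : Type*} (Γ : SimpleGraph V) (P : V → V) (ht : V → ℤ) : Prop where
  adj_iff : ∀ u v, Γ.Adj u v ↔ P u = v ∨ P v = u
  ht_parent : ∀ v, ht (P v) = ht v + 1
  exists_iterate_eq : ∀ u v, ∃ i j : ℕ, P^[i] u = P^[j] v

namespace IsRootedAtEnd

variable {V : Type*} {Γ : SimpleGraph V} {P : V → V} {ht : V → ℤ}

theorem adj_parent (h : IsRootedAtEnd Γ P ht) (v : V) : Γ.Adj v (P v) :=
  (h.adj_iff _ _).2 (.inl rfl)

theorem ht_iterate (h : IsRootedAtEnd Γ P ht) (k : ℕ) (v : V) : ht (P^[k] v) = ht v + k := by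
  induction k with
  | zero => simp
  | succ k ih => rw [Function.iterate_succ_apply', h.ht_parent, ih, Nat.cast_succ, add_assoc]

theorem preconnected (h : IsRootedAtEnd Γ P ht) : Γ.Preconnected := fun u v =>
  let ⟨_, _, huv⟩ := h.exists_iterate_eq u v
  (exists_walk_of_iterate_eq h.adj_parent huv).elim fun p _ => p.reachable

theorem dist_le_of_iterate_eq (h : IsRootedAtEnd Γ P ht) {u v : V} {i j : ℕ}
    (huv : P^[i] u = P^[j] v) : Γ.dist u v ≤ i + j := by
  obtain ⟨p, hp⟩ := exists_walk_of_iterate_eq h.adj_parent huv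
  exact hp ▸ SimpleGraph.dist_le p

theorem exists_iterate_eq_dist (h : IsRootedAtEnd Γ P ht) (u v : V) :
    ∃ i j : ℕ, P^[i] u = P^[j] v ∧ i + j = Γ.dist u v ∧ ht u + i = ht v + j := by
  obtain ⟨p, hp⟩ := (h.preconnected u v).exists_walk_length_eq_dist
  obtain ⟨i, j, hij, hle⟩ := exists_iterate_eq_of_walk (fun _ _ => (h.adj_iff _ _).1) p
  refine ⟨i, j, hij, le_antisymm (hp ▸ hle) (h.dist_le_of_iterate_eq hij), ?_⟩
  rw [← h.ht_iterate, ← h.ht_iterate, hij]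

theorem abs_ht_sub_le_dist (h : IsRootedAtEnd Γ P ht) (u v : V) :
    |ht u - ht v| ≤ Γ.dist u v := by
  obtain ⟨i, j, -, hdist, hht⟩ := h.exists_iterate_eq_dist u v
  rw [abs_le]
  lia

theorem dist_iterate (h : IsRootedAtEnd Γ P ht) (k : ℕ) (v : V) : Γ.dist v (P^[k] v) = k := by
  have upper : Γ.dist v (P^[k] v) ≤ k + 0 := h.dist_le_of_iterate_eq rfl
  have lower := h.abs_ht_sub_le_dist v (P^[k] v)
  rw [h.ht_iterate, abs_le] at lower
  lia

-- The lowest common ancestor of `u` and `v` has height `(Γ.dist u v + ht u + ht v) / 2`.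
theorem dist_add_ht_le_max (h : IsRootedAtEnd Γ P ht) (x y z : V) :
    (Γ.dist x z : ℤ) + ht x + ht z ≤
      max ((Γ.dist x y : ℤ) + ht x + ht y) ((Γ.dist y z : ℤ) + ht y + ht z) := by
  obtain ⟨i, j, hij, hxy, hht⟩ := h.exists_iterate_eq_dist x y
  obtain ⟨k, l, hkl, hyz, hht'⟩ := h.exists_iterate_eq_dist y z
  rcases le_total j k with hjk | hjk
  · have hxz : P^[k - j + i] x = P^[l] z := by
      rw [Function.iterate_add_apply, hij, ← Function.iterate_add_apply, Nat.sub_add_cancel hjk,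
        hkl]
    have := h.dist_le_of_iterate_eq hxz
    exact le_max_of_le_right (by lia)
  · have hxz : P^[i] x = P^[j - k + l] z := by
      rw [hij, Function.iterate_add_apply, ← hkl, ← Function.iterate_add_apply,
        Nat.sub_add_cancel hjk]
    have := h.dist_le_of_iterate_eq hxz
    exact le_max_of_le_left (by lia)

theorem four_point (h : IsRootedAtEnd Γ P ht) (o x y z : V) :
    Γ.dist o y + Γ.dist x z ≤
      max (Γ.dist o x + Γ.dist y z) (Γ.dist o z + Γ.dist x y) := by
  have hoxy := h.dist_add_ht_le_max o x y
  have hozy := h.dist_add_ht_le_max o z y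
  have hxoz := h.dist_add_ht_le_max x o z
  have hxyz := h.dist_add_ht_le_max x y z
  rw [Γ.dist_comm (u := z) (v := y)] at hozy
  rw [Γ.dist_comm (u := x) (v := o)] at hxoz
  rw [le_max_iff] at *
  lia

theorem min_gromovProduct_le (h : IsRootedAtEnd Γ P ht) (o x y z : V) :
    min (gromovProduct Γ o x y) (gromovProduct Γ o y z) ≤ gromovProduct Γ o x z := by
  have four : (Γ.dist o y : ℝ) + Γ.dist x z ≤
      max ((Γ.dist o x : ℝ) + Γ.dist y z) (Γ.dist o z + Γ.dist x y) :=
    mod_cast h.four_point o x y z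
  simp only [gromovProduct]
  grind

theorem isHyperbolic (h : IsRootedAtEnd Γ P ht) : IsHyperbolic Γ :=
  ⟨0, fun o x y z => by simpa using h.min_gromovProduct_le o x y z⟩

-- The lowest vertex of a cycle would have two different parents.
theorem isAcyclic (h : IsRootedAtEnd Γ P ht) : Γ.IsAcyclic := by
  classical
  intro u c hc
  obtain ⟨v, hv, hmin⟩ := c.support.toFinset.exists_min_image ht ⟨u, by simp⟩
  rw [List.mem_toFinset] at hv
  have eq_parent : ∀ t ∈ (c.rotate v hv).support, Γ.Adj v t → P v = t := by
    intro t ht' hvt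
    refine ((h.adj_iff v t).1 hvt).resolve_right fun hPt => ?_
    have := hmin t (by simpa using ht')
    have := h.ht_parent t
    rw [hPt] at this
    lia
  have hc' : (c.rotate v hv).IsCycle := hc.rotate hv
  have snd_eq := eq_parent _ ((c.rotate v hv).getVert_mem_support 1)
    ((c.rotate v hv).adj_snd hc'.not_nil)
  have penultimate_eq := eq_parent _ ((c.rotate v hv).getVert_mem_support _)
    ((c.rotate v hv).adj_penultimate hc'.not_nil).symm
  exact hc'.snd_ne_penultimate (snd_eq.symm.trans penultimate_eq)

theorem isTree [Nonempty V] (h : IsRootedAtEnd Γ P ht) : Γ.IsTree :=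
  ⟨⟨h.preconnected⟩, h.isAcyclic⟩

end IsRootedAtEnd

/-! ### Rough similarities -/

section RoughSimilarity

variable {V W : Type*} {Γ : SimpleGraph V} {Δ : SimpleGraph W} {f : V → W} {m K : ℝ}

/-- `f` multiplies distances by `m`, up to an additive error `K`. -/
def IsRoughSimilarity (Γ : SimpleGraph V) (Δ : SimpleGraph W) (f : V → W) (m K : ℝ) : Prop :=
  ∀ x y, |(Δ.dist (f x) (f y) : ℝ) - m * Γ.dist x y| ≤ K

theorem IsRoughSimilarity.abs_gromovProduct_sub_le (hf : IsRoughSimilarity Γ Δ f m K)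
    (o x y : V) :
    |gromovProduct Δ (f o) (f x) (f y) - m * gromovProduct Γ o x y| ≤ 3 / 2 * K := by
  have hox := abs_le.1 (hf o x)
  have hoy := abs_le.1 (hf o y)
  have hxy := abs_le.1 (hf x y)
  rw [abs_le]
  simp only [gromovProduct]
  constructor <;> linarith

theorem IsRoughSimilarity.isHyperbolic (hf : IsRoughSimilarity Γ Δ f m K) (hm : 0 < m)
    (hΔ : IsHyperbolic Δ) : IsHyperbolic Γ := by
  obtain ⟨δ, hδ⟩ := hΔ
  refine ⟨(δ + 3 * K) / m, fun o x y z => le_of_mul_le_mul_left ?_ hm⟩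
  have hxy := abs_le.1 (hf.abs_gromovProduct_sub_le o x y)
  have hyz := abs_le.1 (hf.abs_gromovProduct_sub_le o y z)
  have hxz := abs_le.1 (hf.abs_gromovProduct_sub_le o x z)
  have hδ' := hδ (f o) (f x) (f y) (f z)
  rw [mul_sub, mul_div_cancel₀ _ hm.ne', mul_min_of_nonneg _ _ hm.le]
  rw [sub_le_iff_le_add, min_le_iff] at hδ' ⊢
  exact hδ'.imp (fun _ => by linarith) (fun _ => by linarith)

end RoughSimilarity

section Actions

variable {G V W : Type*} [Group G] {Γ : SimpleGraph V} {Δ : SimpleGraph W}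
  {α : G →* (Γ ≃g Γ)} {β : G →* (Δ ≃g Δ)}

theorem IsRoughSimilarity.isEquivariantlyQuasiIsometric {f : V → W} {m K R : ℝ}
    (hf : IsRoughSimilarity Γ Δ f m K) (hm : 0 < m) (hR : 0 ≤ R)
    (hfR : ∀ y, ∃ x, Δ.dist (f x) y ≤ R) (map_smul : ∀ g x, f (α g x) = β g (f x)) :
    IsEquivariantlyQuasiIsometric α β := by
  by_cases hV : Nonempty V
  · obtain ⟨x₀⟩ := hV
    have hK : 0 ≤ K := (abs_nonneg _).trans (hf x₀ x₀)
    have hm' := inv_pos.2 hm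
    refine ⟨f, map_smul, m + m⁻¹ + K + R + 1, by linarith, fun x y => ?_, fun x y => ?_,
      fun y => ?_⟩
    · have hxy := abs_le.1 (hf x y)
      have : m * Γ.dist x y ≤ (m + m⁻¹ + K + R + 1) * Γ.dist x y := by gcongr; linarith
      linarith
    · have hxy := abs_le.1 (hf x y)
      have : (Γ.dist x y : ℝ) / (m + m⁻¹ + K + R + 1) ≤ m * Γ.dist x y := by
        rw [div_eq_inv_mul]
        gcongr
        exact inv_le_of_inv_le₀ hm (by linarith)
      linarith
    · obtain ⟨x, hx⟩ := hfR y
      exact ⟨x, by linarith⟩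
  · have : IsEmpty V := not_nonempty_iff.1 hV
    exact ⟨f, map_smul, 1, le_rfl, fun x => isEmptyElim x, fun x => isEmptyElim x,
      fun y => isEmptyElim (hfR y).choose⟩

theorem IsEquivariantlyQuasiIsometric.isEquivalent (h : IsEquivariantlyQuasiIsometric α β)
    (hΔ : Δ.Preconnected) : IsEquivalent α β := by
  obtain ⟨f, map_smul, L, hL, upper, lower, dense⟩ := h
  choose σ hσ using dense
  have triangle (a b c : W) : (Δ.dist a c : ℝ) ≤ Δ.dist a b + Δ.dist b c :=
    mod_cast (hΔ a b).dist_triangle_left c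
  have lower' (x y : V) : (Γ.dist x y : ℝ) ≤ L * (Δ.dist (f x) (f y) + L) := by
    rw [← div_le_iff₀' (by linarith)]
    linarith [lower x y]
  refine ⟨⟨σ, ⟨3 * L ^ 2 + L, fun x y => ?_⟩, fun x => ⟨3 * L ^ 2, fun g => ?_⟩⟩,
    ⟨f, ⟨L, upper⟩, fun x => ⟨0, fun g => by simp [map_smul]⟩⟩⟩
  · have image : (Δ.dist (f (σ x)) (f (σ y)) : ℝ) ≤ 2 * L + Δ.dist x y := by
      have hy := hσ y
      rw [Δ.dist_comm] at hy
      linarith [triangle (f (σ x)) x (f (σ y)), triangle x y (f (σ y)), hσ x]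
    calc (Γ.dist (σ x) (σ y) : ℝ) ≤ L * (2 * L + Δ.dist x y + L) :=
          (lower' _ _).trans (by gcongr)
      _ = L * Δ.dist x y + 3 * L ^ 2 := by ring
      _ ≤ (3 * L ^ 2 + L) * Δ.dist x y + (3 * L ^ 2 + L) := by
          have : 0 ≤ 3 * L ^ 2 * Δ.dist x y := by positivity
          linarith
  · have image : (Δ.dist (f (σ (β g x))) (f (α g (σ x))) : ℝ) ≤ 2 * L := by
      have hx := hσ x
      rw [← dist_iso (β g), ← map_smul, Δ.dist_comm] at hx
      linarith [triangle (f (σ (β g x))) (β g x) (f (α g (σ x))), hσ (β g x)]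
    calc (Γ.dist (σ (β g x)) (α g (σ x)) : ℝ) ≤ L * (2 * L + L) :=
          (lower' _ _).trans (by gcongr)
      _ = 3 * L ^ 2 := by ring

theorem IsCobounded.exists_dist_le (hα : IsCobounded α) (hΓ : Γ.Preconnected) (w : V) :
    ∃ R : ℕ, ∀ v, ∃ g, Γ.dist (α g w) v ≤ R := by
  obtain ⟨x, R, hR⟩ := hα
  refine ⟨Γ.dist w x + R, fun v => ?_⟩
  obtain ⟨g, hg⟩ := hR v
  refine ⟨g, ((hΓ (α g w) (α g x)).dist_triangle_left v).trans ?_⟩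
  rw [dist_iso]
  exact Nat.add_le_add_left hg _

end Actions

/-! ### Word metrics -/

section WordMetric

variable {G V : Type*} [Group G] {A : Set G} {Γ : SimpleGraph V} {α : G →* (Γ ≃g Γ)}

theorem exists_mulCayley_walk_of_mem_pow {n : ℕ} {x y : G} (hxy : x⁻¹ * y ∈ A ^ n) :
    ∃ p : (SimpleGraph.mulCayley A).Walk x y, p.length ≤ n := by
  induction n generalizing y with
  | zero =>
    obtain rfl : x = y := by simpa [inv_mul_eq_one] using hxy
    exact ⟨.nil, le_rfl⟩
  | succ n ih =>
    rw [pow_succ] at hxy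
    obtain ⟨b, hb, a, ha, hba⟩ := hxy
    obtain rfl : x * b * a = y := by rw [mul_assoc, show b * a = _ from hba, mul_inv_cancel_left]
    obtain ⟨p, hp⟩ := ih (y := x * b) (by simpa using hb)
    obtain ha₁ | ha₁ := eq_or_ne a 1
    · exact ⟨p.copy rfl (by simp [ha₁]), by rw [SimpleGraph.Walk.length_copy]; lia⟩
    · have hadj : (SimpleGraph.mulCayley A).Adj (x * b) (x * b * a) :=
        (SimpleGraph.mulCayley_adj' A _ _).2 ⟨by simpa using ha₁, a, ha, .inl rfl⟩
      exact ⟨p.concat hadj, by rw [SimpleGraph.Walk.length_concat]; lia⟩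

theorem closure_eq_top_of_forall_mem_pow (hA : ∀ g, ∃ n : ℕ, g ∈ A ^ n) :
    Subgroup.closure A = ⊤ :=
  (Subgroup.eq_top_iff' _).2 fun g =>
    let ⟨_, hg⟩ := hA g
    Subgroup.pow_subset Subgroup.subset_closure hg

theorem dist_orbit_le_mul_mulCayley_dist {w : V} {m : ℕ} (hΓ : Γ.Preconnected)
    (hm : ∀ a ∈ A, Γ.dist w (α a w) ≤ m) {x y : G}
    (hxy : (SimpleGraph.mulCayley A).Reachable x y) :
    Γ.dist (α x w) (α y w) ≤ m * (SimpleGraph.mulCayley A).dist x y := by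
  obtain ⟨p, hp⟩ := hxy.exists_walk_length_eq_dist
  rw [← hp]
  clear hp hxy
  induction p with
  | nil => simp
  | @cons x y z hxy p ih =>
    have step : Γ.dist (α x w) (α y w) ≤ m := by
      obtain ⟨-, a, ha, rfl | rfl⟩ := (SimpleGraph.mulCayley_adj' A _ _).1 hxy
      · rw [map_mul, RelIso.mul_apply, dist_iso]
        exact hm a ha
      · rw [map_mul, RelIso.mul_apply, dist_iso, Γ.dist_comm]
        exact hm a ha
    calc Γ.dist (α x w) (α z w) ≤ Γ.dist (α x w) (α y w) + Γ.dist (α y w) (α z w) :=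
          (hΓ _ _).dist_triangle_left _
      _ ≤ m + m * p.length := Nat.add_le_add step ih
      _ = m * (SimpleGraph.Walk.cons hxy p).length := by
          rw [SimpleGraph.Walk.length_cons, mul_add_one, add_comm]

theorem isEquivariantlyQuasiIsometric_cayleyAction {w : V} {m K : ℝ}
    (hw : IsRoughSimilarity (SimpleGraph.mulCayley A) Γ (fun g => α g w) m K) (hm : 0 < m)
    (hΓ : Γ.Preconnected) (hα : IsCobounded α) :
    IsEquivariantlyQuasiIsometric (cayleyAction A) α := by
  obtain ⟨R, hR⟩ := hα.exists_dist_le hΓ w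
  refine hw.isEquivariantlyQuasiIsometric hm R.cast_nonneg (fun v => ?_) fun g x => ?_
  · exact (hR v).imp fun _ hg => mod_cast hg
  · change α (g * x) w = _
    rw [map_mul, RelIso.mul_apply]

theorem isRepresentedBy_of_isRoughSimilarity {w : V} {m K : ℝ}
    (hw : IsRoughSimilarity (SimpleGraph.mulCayley A) Γ (fun g => α g w) m K) (hm : 0 < m)
    (hA : Subgroup.closure A = ⊤) (hΓ : Γ.Connected) (hyp : IsHyperbolic Γ)
    (hα : IsCobounded α) : IsRepresentedBy A α :=
  ⟨⟨hA, hw.isHyperbolic hm hyp⟩, hΓ, hyp, hα,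
    (isEquivariantlyQuasiIsometric_cayleyAction hw hm hΓ.1 hα).isEquivalent hΓ.1⟩

end WordMetric

/-! ### Actions fixing an end, with an axis through a vertex -/

/-- `Γ` is the tree of the parent function `P` with height `ht`, and `α` fixes its distinguished
end: it preserves `P` and shifts the height through the character `χ`. -/
structure FixesEnd {G V : Type*} [Group G] {Γ : SimpleGraph V} (α : G →* (Γ ≃g Γ)) (P : V → V)
    (ht : V → ℤ) (χ : G →* Multiplicative ℤ) : Prop extends IsRootedAtEnd Γ P ht where
  map_parent : ∀ g v, α g (P v) = P (α g v)
  ht_map : ∀ g v, ht (α g v) = ht v + (χ g).toAdd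

/-- The elements of `Z` translate along the same line through `w`: those with `χ z ≥ 0` move `w` to
its ancestor `χ z` steps above. -/
structure IsAxial {G V : Type*} [Group G] (Z : Subgroup G) {Γ : SimpleGraph V}
    (α : G →* (Γ ≃g Γ)) (P : V → V) (ht : V → ℤ) (χ : G →* Multiplicative ℤ) (w : V) : Prop
    extends FixesEnd α P ht χ where
  axis : ∀ z ∈ Z, ∀ k : ℕ, (χ z).toAdd = k → α z w = P^[k] w

section Axial

variable {G V : Type*} [Group G] {Γ : SimpleGraph V} {α : G →* (Γ ≃g Γ)} {P : V → V}
  {ht : V → ℤ} {χ : G →* Multiplicative ℤ}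

theorem FixesEnd.map_iterate (h : FixesEnd α P ht χ) (g : G) (k : ℕ) (v : V) :
    α g (P^[k] v) = P^[k] (α g v) :=
  (show Function.Commute (α g) P from h.map_parent g).iterate_right k v

namespace IsAxial

variable {H Z : Subgroup G} {w : V}

theorem iterate_map (h : IsAxial Z α P ht χ w) {z : G} (hz : z ∈ Z) {i j : ℕ}
    (hij : (i : ℤ) = j + (χ z).toAdd) : P^[j] (α z w) = P^[i] w := by
  rcases le_total j i with hji | hij'
  · rw [h.axis z hz (i - j) (by lia), ← Function.iterate_add_apply, Nat.add_sub_cancel' hji]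
  · have inv_axis := h.axis z⁻¹ (inv_mem hz) (j - i) (by rw [map_inv, toAdd_inv]; lia)
    have axis : w = P^[j - i] (α z w) := by
      rw [← h.map_iterate, ← inv_axis, ← RelIso.mul_apply, ← map_mul, mul_inv_cancel, map_one,
        RelIso.one_apply]
    conv_rhs => rw [axis]
    rw [← Function.iterate_add_apply, Nat.add_sub_cancel' hij']

theorem dist_self_map (h : IsAxial Z α P ht χ w) {z : G} (hz : z ∈ Z) :
    (Γ.dist w (α z w) : ℤ) = |(χ z).toAdd| := by
  have lower := h.abs_ht_sub_le_dist (α z w) w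
  have upper := h.dist_le_of_iterate_eq
    (h.iterate_map hz (i := (χ z).toAdd.toNat) (j := (-(χ z).toAdd).toNat) (by lia)).symm
  rw [h.ht_map, add_sub_cancel_left, Γ.dist_comm] at lower
  rw [abs_eq_max_neg] at *
  lia

theorem dist_map_map (h : IsAxial Z α P ht χ w) {z z' : G} (hz : z ∈ Z) (hz' : z' ∈ Z) :
    (Γ.dist (α z w) (α z' w) : ℤ) = |(χ z).toAdd - (χ z').toAdd| := by
  have := h.dist_self_map (mul_mem (inv_mem hz) hz')
  rw [← dist_iso (α z), ← RelIso.mul_apply, ← map_mul, mul_inv_cancel_left] at this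
  rw [this, map_mul, map_inv, toAdd_mul, toAdd_inv, abs_sub_comm, neg_add_eq_sub]

theorem fixes_iterate (h : IsAxial Z α P ht χ w) {x z : G} {i j : ℕ} (hx : χ x = 1)
    (hz : z ∈ Z) (hij : P^[i] w = P^[j] (α (x * z) w)) :
    (i : ℤ) = j + (χ z).toAdd ∧ α x (P^[i] w) = P^[i] w := by
  have hχz : (i : ℤ) = j + (χ z).toAdd := by
    have := congrArg ht hij
    rw [h.ht_iterate, h.ht_iterate, h.ht_map, map_mul, hx, one_mul] at this
    lia
  rw [map_mul, RelIso.mul_apply, ← h.map_iterate, h.iterate_map hz hχz] at hij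
  exact ⟨hχz, hij.symm⟩

theorem conj_mem_vertexStabilizer [H.Normal] (h : IsAxial Z α P ht χ w) {x z : G} {i : ℕ}
    (hz : z ∈ Z) (hi : (i : ℤ) ≤ (χ z).toAdd) (hx : x ∈ H) (hfix : α x (P^[i] w) = P^[i] w) :
    z⁻¹ * x * z ∈ vertexStabilizer α H w := by
  obtain ⟨k, hk⟩ := Int.le.dest hi
  have axis : α z w = P^[k] (P^[i] w) := by
    rw [← Function.iterate_add_apply]
    exact h.axis z hz (k + i) (by lia)
  refine ⟨by simpa using ‹H.Normal›.conj_mem x hx z⁻¹, ?_⟩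
  simp only [map_mul, RelIso.mul_apply]
  rw [axis, h.map_iterate, hfix, ← axis, ← RelIso.mul_apply, ← map_mul, inv_mul_cancel, map_one,
    RelIso.one_apply]

end IsAxial

/-! ### The word metric of an axial action -/

theorem mem_pow_of_mem_subgroup {Z : Subgroup G} {e : G} {m : ℕ} (hm : 0 < m) (he : e ∈ Z)
    (hχe : (χ e).toAdd = m) {z : G} (hz : z ∈ Z) :
    z ∈ {g | g ∈ Z ∧ |(χ g).toAdd| ≤ m} ^ ((χ z).toAdd.natAbs / m + 1) := by
  set S : Set G := {g | g ∈ Z ∧ |(χ g).toAdd| ≤ m} with hS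
  wlog hpos : 0 ≤ (χ z).toAdd generalizing z
  · have hinv : S⁻¹ = S := by ext g; simp [hS]
    rw [← hinv, inv_pow, Set.mem_inv]
    simpa using this (inv_mem hz) (by rw [map_inv, toAdd_inv]; lia)
  set q := (χ z).toAdd.natAbs / m
  have remainder : (e ^ q)⁻¹ * z ∈ S := by
    refine ⟨mul_mem (inv_mem (pow_mem he q)) hz, ?_⟩
    have division := Nat.div_add_mod (χ z).toAdd.natAbs m
    have mod_lt := Nat.mod_lt (χ z).toAdd.natAbs hm
    have value : (χ ((e ^ q)⁻¹ * z)).toAdd = ((χ z).toAdd.natAbs % m : ℕ) := by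
      simp only [map_mul, map_inv, map_pow, toAdd_mul, toAdd_inv, toAdd_pow, hχe, nsmul_eq_mul]
      lia
    rw [value, abs_of_nonneg (Int.natCast_nonneg _)]
    exact_mod_cast mod_lt.le
  rw [pow_succ, ← mul_inv_cancel_left (e ^ q) z]
  exact Set.mul_mem_mul (Set.pow_mem_pow ⟨he, by simp [hχe]⟩) remainder

/-- The generating set `Stab_H(w) ∪ {z ∈ Z | |χ z| ≤ m}` of an axial action. -/
def axialGenerators (α : G →* (Γ ≃g Γ)) (χ : G →* Multiplicative ℤ) (H Z : Subgroup G) (w : V)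
    (m : ℕ) : Set G :=
  (vertexStabilizer α H w : Set G) ∪ {g | g ∈ Z ∧ |(χ g).toAdd| ≤ m}

namespace IsAxial

variable {H Z : Subgroup G} {w : V} {e : G} {m : ℕ}

theorem mem_axialGenerators_pow [H.Normal] (h : IsAxial Z α P ht χ w) (hH : H ≤ χ.ker)
    (hHZ : H ⊔ Z = ⊤) (hm : 0 < m) (he : e ∈ Z) (hχe : (χ e).toAdd = m) {g : G} {i j : ℕ}
    (hij : P^[i] w = P^[j] (α g w)) :
    g ∈ axialGenerators α χ H Z w m ^ (i / m + j / m + 4) := by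
  obtain ⟨x, hx, z, hz, rfl⟩ := Subgroup.mem_sup_of_normal_left.1 (hHZ ▸ Subgroup.mem_top g)
  obtain ⟨hχz, hfix⟩ := h.fixes_iterate (hH hx) hz hij
  set k := i / m + 1 with hk
  have hmk : i < m * k := Nat.lt_mul_div_succ i hm
  have hmk' : m * k ≤ i + m := by
    rw [hk, mul_add_one]
    exact Nat.add_le_add_right (Nat.mul_div_le i m) m
  have hχk : (χ (e ^ k)).toAdd = m * k := by
    rw [map_pow, toAdd_pow, hχe, nsmul_eq_mul, mul_comm]
  have stab_mem : (e ^ k)⁻¹ * x * e ^ k ∈ vertexStabilizer α H w :=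
    h.conj_mem_vertexStabilizer (pow_mem he k) (by rw [hχk]; exact_mod_cast hmk.le) hx hfix
  have tail_mem := mem_pow_of_mem_subgroup hm he hχe (mul_mem (inv_mem (pow_mem he k)) hz)
  have tail_le : (χ ((e ^ k)⁻¹ * z)).toAdd.natAbs / m ≤ j / m + 1 := by
    rw [← Nat.add_div_right j hm, map_mul, map_inv, toAdd_mul, toAdd_inv, hχk]
    refine Nat.div_le_div_right ?_
    lia
  have subset : {g | g ∈ Z ∧ |(χ g).toAdd| ≤ m} ⊆ axialGenerators α χ H Z w m :=
    Set.subset_union_right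
  have factors : e ^ k * ((e ^ k)⁻¹ * x * e ^ k) * ((e ^ k)⁻¹ * z) ∈
      axialGenerators α χ H Z w m ^ (k + 1 +
        ((χ ((e ^ k)⁻¹ * z)).toAdd.natAbs / m + 1)) := by
    rw [pow_add, pow_succ]
    exact Set.mul_mem_mul (Set.mul_mem_mul (Set.pow_mem_pow (subset ⟨he, by simp [hχe]⟩))
      (.inl stab_mem)) (Set.pow_subset_pow_left subset tail_mem)
  refine Set.pow_subset_pow_right (.inl (one_mem _)) ?_ (by convert factors using 1; group)
  lia

theorem isRoughSimilarity [H.Normal] (h : IsAxial Z α P ht χ w) (hH : H ≤ χ.ker)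
    (hHZ : H ⊔ Z = ⊤) (hm : 0 < m) (he : e ∈ Z) (hχe : (χ e).toAdd = m) :
    IsRoughSimilarity (SimpleGraph.mulCayley (axialGenerators α χ H Z w m)) Γ
      (fun g => α g w) m (4 * m) := by
  intro x y
  obtain ⟨i, j, hij, hdist, -⟩ := h.exists_iterate_eq_dist w (α (x⁻¹ * y) w)
  have dist_eq : Γ.dist w (α (x⁻¹ * y) w) = Γ.dist (α x w) (α y w) := by
    rw [← dist_iso (α x), ← RelIso.mul_apply, ← map_mul, mul_inv_cancel_left]
  obtain ⟨p, hp⟩ := exists_mulCayley_walk_of_mem_pow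
    (h.mem_axialGenerators_pow hH hHZ hm he hχe hij)
  have generator_dist_le : ∀ a ∈ axialGenerators α χ H Z w m, Γ.dist w (α a w) ≤ m := by
    rintro a (⟨-, hfix⟩ | ⟨ha, hχa⟩)
    · simp [hfix]
    · exact_mod_cast (h.dist_self_map ha).trans_le hχa
  have upper := dist_orbit_le_mul_mulCayley_dist h.preconnected generator_dist_le p.reachable
  have lower : m * (SimpleGraph.mulCayley (axialGenerators α χ H Z w m)).dist x y ≤
      Γ.dist (α x w) (α y w) + 4 * m := by
    refine (Nat.mul_le_mul_left m ((SimpleGraph.dist_le p).trans hp)).trans ?_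
    linarith [Nat.mul_div_le i m, Nat.mul_div_le j m]
  have abs_le : |(Γ.dist (α x w) (α y w) : ℤ) -
      m * (SimpleGraph.mulCayley (axialGenerators α χ H Z w m)).dist x y| ≤ 4 * m := by
    rw [_root_.abs_le]
    lia
  exact_mod_cast abs_le

theorem closure_axialGenerators [H.Normal] (h : IsAxial Z α P ht χ w) (hH : H ≤ χ.ker)
    (hHZ : H ⊔ Z = ⊤) (hm : 0 < m) (he : e ∈ Z) (hχe : (χ e).toAdd = m) :
    Subgroup.closure (axialGenerators α χ H Z w m) = ⊤ :=
  closure_eq_top_of_forall_mem_pow fun g =>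
    let ⟨_, _, hij⟩ := h.exists_iterate_eq w (α g w)
    ⟨_, h.mem_axialGenerators_pow hH hHZ hm he hχe hij⟩

theorem isRepresentedBy [H.Normal] (h : IsAxial Z α P ht χ w) (hH : H ≤ χ.ker)
    (hHZ : H ⊔ Z = ⊤) (hm : 0 < m) (he : e ∈ Z) (hχe : (χ e).toAdd = m) (hα : IsCobounded α) :
    IsRepresentedBy (axialGenerators α χ H Z w m) α :=
  isRepresentedBy_of_isRoughSimilarity (h.isRoughSimilarity hH hHZ hm he hχe)
    (mod_cast hm) (h.closure_axialGenerators hH hHZ hm he hχe)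
    ((SimpleGraph.connected_iff _).2 ⟨h.preconnected, ⟨w⟩⟩) h.isHyperbolic hα

end IsAxial

theorem slab_eq {Z : Subgroup G} {ρ : Z →* Multiplicative ℝ} {r : ℝ} (hr : 0 < r)
    (hρ : ∀ z : Z, (ρ z).toAdd = r * (χ z).toAdd) {e : Z} {m : ℕ} (hχe : (χ e).toAdd = m) :
    slab ρ (ρ e).toAdd = {g | g ∈ Z ∧ |(χ g).toAdd| ≤ m} := by
  have abs_le_iff (z : Z) : |(ρ z).toAdd| ≤ (ρ e).toAdd ↔ |(χ z).toAdd| ≤ m := by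
    rw [hρ, hρ, abs_mul, abs_of_pos hr, mul_le_mul_iff_right₀ hr, hχe]
    norm_cast
  ext g
  constructor
  · rintro ⟨z, rfl, hz⟩
    exact ⟨z.2, (abs_le_iff z).1 hz⟩
  · rintro ⟨hg, hg'⟩
    exact ⟨⟨g, hg⟩, rfl, (abs_le_iff ⟨g, hg⟩).2 hg'⟩

theorem IsAxial.isRepresentedBy_union_slab {H Z : Subgroup G} {w : V} [H.Normal]
    (h : IsAxial Z α P ht χ w) (hH : H ≤ χ.ker) (hHZ : H ⊔ Z = ⊤) (hα : IsCobounded α)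
    {ρ : Z →* Multiplicative ℝ} {r : ℝ} (hr : 0 < r)
    (hρ : ∀ z : Z, (ρ z).toAdd = r * (χ z).toAdd) {e : Z} (he : 0 < (ρ e).toAdd) :
    IsRepresentedBy ((vertexStabilizer α H w : Set G) ∪ slab ρ (ρ e).toAdd) α ∧
      IsEquivariantlyQuasiIsometric
        (cayleyAction ((vertexStabilizer α H w : Set G) ∪ slab ρ (ρ e).toAdd)) α := by
  have hχe : 0 < (χ e).toAdd := by
    rw [hρ, mul_pos_iff_of_pos_left hr] at he
    exact_mod_cast he
  obtain ⟨m, hm⟩ := Int.eq_ofNat_of_zero_le hχe.le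
  have hm₀ : 0 < m := by lia
  rw [slab_eq hr hρ hm]
  exact ⟨h.isRepresentedBy hH hHZ hm₀ e.2 hm hα,
    isEquivariantlyQuasiIsometric_cayleyAction (h.isRoughSimilarity hH hHZ hm₀ e.2 hm)
      (mod_cast hm₀) h.preconnected hα⟩

end Axial

/-! ### Ascending HNN-extensions -/

section Hull

variable {G : Type*} [Group G] {K : Subgroup G} {a : G}

theorem pow_conj_mem (hK : ∀ k ∈ K, a⁻¹ * k * a ∈ K) (n : ℕ) {k : G} (hk : k ∈ K) :
    (a ^ n)⁻¹ * k * a ^ n ∈ K := by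
  induction n with
  | zero => simpa using hk
  | succ n ih =>
    convert hK _ ih using 1
    group

theorem pow_mul_mul_pow_mem_of_le (hK : ∀ k ∈ K, a⁻¹ * k * a ∈ K) {g : G} {i j : ℕ}
    (hg : (a ^ i)⁻¹ * g * a ^ j ∈ K) (s : ℕ) : (a ^ (i + s))⁻¹ * g * a ^ (j + s) ∈ K := by
  convert pow_conj_mem hK s hg using 1
  group

/-- The subgroup `⋃ aⁱ K a⁻ʲ`, for `K` with `a⁻¹ K a ≤ K`; it is generated by `K` and `a`. -/
def ascendingHull (K : Subgroup G) (a : G) (hK : ∀ k ∈ K, a⁻¹ * k * a ∈ K) : Subgroup G where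
  carrier := {g | ∃ i j : ℕ, (a ^ i)⁻¹ * g * a ^ j ∈ K}
  one_mem' := ⟨0, 0, by simp⟩
  mul_mem' := by
    rintro g g' ⟨i, j, hg⟩ ⟨i', j', hg'⟩
    refine ⟨i + i', j' + j, ?_⟩
    convert mul_mem (pow_mul_mul_pow_mem_of_le hK hg i')
      (pow_mul_mul_pow_mem_of_le hK hg' j) using 1
    rw [add_comm i' j]
    group
  inv_mem' := by
    rintro g ⟨i, j, hg⟩
    exact ⟨j, i, by simpa [mul_assoc] using inv_mem hg⟩

theorem mem_ascendingHull (hK : ∀ k ∈ K, a⁻¹ * k * a ∈ K) {g : G} :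
    g ∈ ascendingHull K a hK ↔ ∃ i j : ℕ, (a ^ i)⁻¹ * g * a ^ j ∈ K :=
  Iff.rfl

theorem le_ascendingHull (hK : ∀ k ∈ K, a⁻¹ * k * a ∈ K) : K ≤ ascendingHull K a hK :=
  fun _ hk => ⟨0, 0, by simpa using hk⟩

theorem self_mem_ascendingHull (hK : ∀ k ∈ K, a⁻¹ * k * a ∈ K) : a ∈ ascendingHull K a hK :=
  ⟨1, 0, by simp⟩

end Hull

section NormalForm

variable {K : Type*} [Group K] {f : K →* K} (hf : Function.Injective f)

/-- The isomorphism `f x ↦ x` from the range of an injective endomorphism `f` onto the whole group;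
it defines the ascending HNN-extension of `f`. -/
noncomputable def rangeEquivTop : f.range ≃* (⊤ : Subgroup K) :=
  (MonoidHom.ofInjective hf).symm.trans Subgroup.topEquiv.symm

theorem rangeEquivTop_apply (k : K) : (rangeEquivTop hf ⟨f k, k, rfl⟩ : K) = k :=
  (MonoidHom.ofInjective hf).symm_apply_apply k

theorem inv_t_mul_of_mul_t (k : K) :
    (HNNExtension.t⁻¹ * HNNExtension.of k * HNNExtension.t :
      HNNExtension K f.range ⊤ (rangeEquivTop hf)) = HNNExtension.of (f k) := by
  rw [← HNNExtension.equiv_symm_eq_conj ⟨k, Subgroup.mem_top k⟩]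
  rfl

theorem exists_eq_pow_mul_of_mul_inv_pow (x : HNNExtension K f.range ⊤ (rangeEquivTop hf)) :
    ∃ (i j : ℕ) (k : K),
      x = HNNExtension.t ^ i * HNNExtension.of k * (HNNExtension.t ^ j)⁻¹ := by
  have conj_mem : ∀ y ∈ (HNNExtension.of :
      K →* HNNExtension K f.range ⊤ (rangeEquivTop hf)).range,
      HNNExtension.t⁻¹ * y * HNNExtension.t ∈ HNNExtension.of.range := by
    rintro _ ⟨k, rfl⟩
    exact ⟨f k, (inv_t_mul_of_mul_t hf k).symm⟩
  have mem_hull : x ∈ ascendingHull _ _ conj_mem := by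
    induction x using HNNExtension.induction_on with
    | of k => exact le_ascendingHull conj_mem ⟨k, rfl⟩
    | t => exact self_mem_ascendingHull conj_mem
    | mul x y hx hy => exact mul_mem hx hy
    | inv x hx => exact inv_mem hx
  obtain ⟨i, j, k, hk⟩ := mem_hull
  exact ⟨i, j, k, by rw [hk]; group⟩

end NormalForm

/-- A criterion inside `G` for being the ascending HNN-extension with base `K` and stable letter
`a`: conjugation by `a` contracts `K`, its inverse powers exhaust `G`, and a character separates
the powers of `a` modulo `K`. -/
structure IsAscending {G : Type*} [Group G] (K : Subgroup G) (a : G) (χ : G →* Multiplicative ℤ) :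
    Prop where
  conj_mem : ∀ k ∈ K, a⁻¹ * k * a ∈ K
  absorbs : ∀ g : G, ∃ i j : ℕ, (a ^ i)⁻¹ * g * a ^ j ∈ K
  le_ker : K ≤ χ.ker
  map_stable : χ a = Multiplicative.ofAdd 1

namespace IsAscending

variable {G : Type*} [Group G] {K : Subgroup G} {a : G} {χ : G →* Multiplicative ℤ}

theorem eq_of_pow_mul_mul_inv_pow_eq_one (h : IsAscending K a χ) {i j : ℕ} {k : G} (hk : k ∈ K)
    (heq : a ^ i * k * (a ^ j)⁻¹ = 1) : i = j ∧ k = 1 := by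
  have hij : i = j := by
    have := congrArg (fun g => (χ g).toAdd) heq
    simp only [map_mul, map_inv, map_pow, MonoidHom.mem_ker.1 (h.le_ker hk), h.map_stable, map_one,
      toAdd_mul, toAdd_inv, toAdd_pow, toAdd_one, toAdd_ofAdd, nsmul_eq_mul] at this
    lia
  refine ⟨hij, ?_⟩
  rwa [hij, mul_inv_eq_one, mul_eq_left] at heq

theorem isAscendingHNN (h : IsAscending K a χ) : IsAscendingHNN K a := by
  let f : K →* K := ((MulAut.conj a⁻¹).toMonoidHom.comp K.subtype).codRestrict K
    fun k => by simpa using h.conj_mem k k.2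
  have coe_f (k : K) : (f k : G) = a⁻¹ * k * a := by simp [f]
  have hf : Function.Injective f := fun k l hkl => by
    have := congrArg Subtype.val hkl
    rw [coe_f, coe_f, mul_left_inj, mul_right_inj] at this
    exact Subtype.ext this
  let F : HNNExtension K f.range ⊤ (rangeEquivTop hf) →* G :=
    HNNExtension.lift K.subtype a <| by
      rintro ⟨_, k, rfl⟩
      change a * (f k : G) = ((rangeEquivTop hf ⟨f k, k, rfl⟩ : K) : G) * a
      rw [rangeEquivTop_apply, coe_f]
      group
  have F_of (k : K) : F (HNNExtension.of k) = k := HNNExtension.lift_of ..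
  have F_t : F HNNExtension.t = a := HNNExtension.lift_t ..
  refine ⟨f.range, rangeEquivTop hf, MulEquiv.ofBijective F ⟨?injective, ?surjective⟩, F_of, F_t⟩
  case injective =>
    rw [injective_iff_map_eq_one]
    intro x hx
    obtain ⟨i, j, k, rfl⟩ := exists_eq_pow_mul_of_mul_inv_pow hf x
    simp only [map_mul, map_inv, map_pow, F_of, F_t] at hx
    obtain ⟨rfl, hk⟩ := h.eq_of_pow_mul_mul_inv_pow_eq_one k.2 hx
    rw [show k = 1 from Subtype.ext hk, map_one, mul_one, mul_inv_cancel]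
  case surjective =>
    intro g
    obtain ⟨i, j, hg⟩ := h.absorbs g
    refine ⟨HNNExtension.t ^ i * HNNExtension.of ⟨_, hg⟩ * (HNNExtension.t ^ j)⁻¹, ?_⟩
    simp only [map_mul, map_inv, map_pow, F_of, F_t]
    group

end IsAscending

/-! ### The Bass–Serre tree of an ascending HNN-extension -/

section BassSerre

variable {G : Type*} [Group G] {K : Subgroup G} {a : G} {χ : G →* Multiplicative ℤ}

/-- The map `gK ↦ gaK`, the parent function of the Bass–Serre tree. -/
def bassSerreParent (hK : ∀ k ∈ K, a⁻¹ * k * a ∈ K) : G ⧸ K → G ⧸ K :=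
  Quotient.map' (· * a) fun g g' hgg' => by
    rw [QuotientGroup.leftRel_apply] at hgg' ⊢
    convert hK _ hgg' using 1
    group

theorem bassSerreParent_mk (hK : ∀ k ∈ K, a⁻¹ * k * a ∈ K) (g : G) :
    bassSerreParent hK (g : G ⧸ K) = ((g * a : G) : G ⧸ K) := rfl

theorem bassSerreParent_iterate_mk (hK : ∀ k ∈ K, a⁻¹ * k * a ∈ K) (n : ℕ) (g : G) :
    (bassSerreParent hK)^[n] (g : G ⧸ K) = ((g * a ^ n : G) : G ⧸ K) := by
  induction n with
  | zero => simp
  | succ n ih => rw [Function.iterate_succ_apply', ih, bassSerreParent_mk, pow_succ, mul_assoc]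

theorem bassSerreAction_mk (g g' : G) :
    bassSerreAction K a g (g' : G ⧸ K) = ((g * g' : G) : G ⧸ K) := rfl

/-- The height `gK ↦ χ g` on the Bass–Serre tree. -/
def bassSerreHeight (hχ : K ≤ χ.ker) : G ⧸ K → ℤ :=
  Quotient.lift (fun g => (χ g).toAdd) fun g g' hgg' => by
    have := MonoidHom.mem_ker.1 (hχ (QuotientGroup.leftRel_apply.1 hgg'))
    rw [map_mul, map_inv, inv_mul_eq_one] at this
    rw [this]

theorem bassSerreHeight_mk (hχ : K ≤ χ.ker) (g : G) :
    bassSerreHeight hχ (g : G ⧸ K) = (χ g).toAdd := rfl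

theorem exists_mk_eq_iff_bassSerreParent_eq (hK : ∀ k ∈ K, a⁻¹ * k * a ∈ K) (u v : G ⧸ K) :
    (∃ g : G, u = g ∧ v = ((g * a : G) : G ⧸ K)) ↔ bassSerreParent hK u = v := by
  constructor
  · rintro ⟨g, rfl, rfl⟩
    rfl
  · rintro rfl
    obtain ⟨g, rfl⟩ := QuotientGroup.mk_surjective u
    exact ⟨g, rfl, rfl⟩

theorem IsAscending.isRootedAtEnd (h : IsAscending K a χ) :
    IsRootedAtEnd (bassSerre K a) (bassSerreParent h.conj_mem) (bassSerreHeight h.le_ker) := by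
  have ht_parent (v : G ⧸ K) : bassSerreHeight h.le_ker (bassSerreParent h.conj_mem v) =
      bassSerreHeight h.le_ker v + 1 := by
    obtain ⟨g, rfl⟩ := QuotientGroup.mk_surjective v
    rw [bassSerreParent_mk, bassSerreHeight_mk, bassSerreHeight_mk, map_mul, h.map_stable,
      toAdd_mul, toAdd_ofAdd]
  have parent_ne (v : G ⧸ K) : bassSerreParent h.conj_mem v ≠ v := fun hv => by
    have := ht_parent v
    rw [hv] at this
    lia
  refine ⟨fun u v => ?_, ht_parent, fun u v => ?_⟩
  · rw [bassSerre, SimpleGraph.fromRel_adj, exists_mk_eq_iff_bassSerreParent_eq h.conj_mem,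
      exists_mk_eq_iff_bassSerreParent_eq h.conj_mem, and_iff_right_iff_imp]
    rintro huv rfl
    exact parent_ne u (or_self_iff.1 huv)
  · obtain ⟨g, rfl⟩ := QuotientGroup.mk_surjective u
    obtain ⟨g', rfl⟩ := QuotientGroup.mk_surjective v
    obtain ⟨i, j, hij⟩ := h.absorbs (g⁻¹ * g')
    refine ⟨i, j, ?_⟩
    rw [bassSerreParent_iterate_mk, bassSerreParent_iterate_mk, QuotientGroup.eq]
    simpa [mul_assoc] using hij

theorem IsAscending.fixesEnd (h : IsAscending K a χ) :
    FixesEnd (bassSerreAction K a) (bassSerreParent h.conj_mem) (bassSerreHeight h.le_ker) χ where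
  toIsRootedAtEnd := h.isRootedAtEnd
  map_parent g v := by
    obtain ⟨g', rfl⟩ := QuotientGroup.mk_surjective v
    simp only [bassSerreParent_mk, bassSerreAction_mk, mul_assoc]
  ht_map g v := by
    obtain ⟨g', rfl⟩ := QuotientGroup.mk_surjective v
    simp only [bassSerreAction_mk, bassSerreHeight_mk, map_mul, toAdd_mul, add_comm]

theorem isCobounded_bassSerreAction : IsCobounded (bassSerreAction K a) :=
  ⟨((1 : G) : G ⧸ K), 0, fun v => by
    obtain ⟨g, rfl⟩ := QuotientGroup.mk_surjective v
    exact ⟨g, by simp [bassSerreAction_mk]⟩⟩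

end BassSerre

/-! ### Discrete characters -/

section Discrete

variable {G : Type*} [Group G] {Z : Subgroup G} {ρ : Z →* Multiplicative ℝ}

theorem exists_isMinimalPositive (hρ : ρ ≠ 1) (hd : IsDiscrete ρ) :
    ∃ a : Z, IsMinimalPositive ρ a := by
  have : IsCyclic ρ.range := hd
  have : Nontrivial ρ.range :=
    (Subgroup.nontrivial_iff_ne_bot _).2 (MonoidHom.range_eq_bot_iff.not.2 hρ)
  obtain ⟨g, hg, hgen⟩ := LinearOrderedCommGroup.Subgroup.exists_generator_lt_one ρ.range
  obtain ⟨b, rfl⟩ : g ∈ ρ.range := hgen ▸ Subgroup.mem_zpowers g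
  have hb : 0 < (ρ b⁻¹).toAdd := by
    rw [map_inv, toAdd_inv]
    exact neg_pos.2 hg
  refine ⟨b⁻¹, hb, fun z hz => ?_⟩
  obtain ⟨k, hk⟩ : ∃ k : ℤ, ρ b⁻¹ ^ k = ρ z := by
    rw [← Subgroup.mem_zpowers_iff, map_inv, Subgroup.zpowers_inv, hgen]
    exact ⟨z, rfl⟩
  rw [← hk, toAdd_zpow, zsmul_eq_mul] at hz ⊢
  have hk_pos : 0 < k := by exact_mod_cast (mul_pos_iff_of_pos_right hb).1 hz
  exact le_mul_of_one_le_left hb.le (by exact_mod_cast hk_pos)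

theorem IsMinimalPositive.exists_zpow_eq {a : Z} (ha : IsMinimalPositive ρ a) (z : Z) :
    ∃ k : ℤ, ρ a ^ k = ρ z := by
  have least : IsLeast {g | g ∈ ρ.range ∧ 1 < g} (ρ a) :=
    ⟨⟨⟨a, rfl⟩, ha.1⟩, by rintro _ ⟨⟨z, rfl⟩, hz⟩; exact ha.2 z hz⟩
  rw [← Subgroup.mem_closure_singleton, ← Subgroup.cyclic_of_min least]
  exact ⟨z, rfl⟩

theorem isDiscrete_of_toAdd_eq_intCast {c : Z → ℤ} (hρ : ∀ z, (ρ z).toAdd = c z) :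
    IsDiscrete ρ := by
  have hle : ρ.range ≤ Subgroup.zpowers (Multiplicative.ofAdd (1 : ℝ)) := by
    rintro _ ⟨z, rfl⟩
    refine Subgroup.mem_zpowers_iff.2 ⟨c z, Multiplicative.toAdd.injective ?_⟩
    rw [hρ, toAdd_zpow, toAdd_ofAdd, zsmul_one]
  exact isCyclic_of_injective (Subgroup.inclusion hle) (Subgroup.inclusion_injective hle)

variable {H : Subgroup G} [H.Normal]

theorem exists_extension_of_isComplement' (hHZ : H.IsComplement' Z) {M : Type*} [Group M]
    (φ : Z →* M) : ∃ χ : G →* M, H ≤ χ.ker ∧ ∀ z : Z, χ z = φ z := by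
  refine ⟨φ.comp (hHZ.symm.QuotientMulEquiv.toMonoidHom.comp (QuotientGroup.mk' H)),
    fun x hx => ?_, fun z => ?_⟩
  · simp only [MonoidHom.mem_ker, MonoidHom.comp_apply, QuotientGroup.mk'_apply,
      (QuotientGroup.eq_one_iff x).2 hx, map_one]
  · exact congrArg φ (hHZ.symm.QuotientMulEquiv.apply_symm_apply z)

theorem IsMinimalPositive.exists_height {a : Z} (ha : IsMinimalPositive ρ a)
    (hHZ : H.IsComplement' Z) : ∃ χ : G →* Multiplicative ℤ, H ≤ χ.ker ∧
      ∀ z : Z, (ρ z).toAdd = (ρ a).toAdd * (χ z).toAdd := by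
  choose k hk using ha.exists_zpow_eq
  have toAdd_eq (z : Z) : (ρ z).toAdd = (ρ a).toAdd * k z := by
    rw [← hk, toAdd_zpow, zsmul_eq_mul, mul_comm]
  have k_mul (z z' : Z) : k (z * z') = k z + k z' := by
    have := toAdd_eq (z * z')
    rw [map_mul, toAdd_mul, toAdd_eq z, toAdd_eq z', ← mul_add] at this
    exact_mod_cast (mul_left_cancel₀ ha.1.ne' this).symm
  obtain ⟨χ, hχH, hχZ⟩ := exists_extension_of_isComplement' hHZ
    (MonoidHom.mk' (fun z => Multiplicative.ofAdd (k z)) fun z z' => by rw [k_mul, ofAdd_add])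
  exact ⟨χ, hχH, fun z => by rw [hχZ]; exact toAdd_eq z⟩

end Discrete

/-! ### Confining subgroups -/

section Confining

variable {G : Type*} [Group G] {H Z : Subgroup G} {ρ : Z →* Multiplicative ℝ}

theorem IsConfining.eq_of_not_isStrictlyConfining {Q : Set G} (hQ : IsConfining H Z ρ Q)
    (hstrict : ¬ IsStrictlyConfining H Z ρ Q) : Q = H := by
  refine hQ.subset.antisymm fun h hh => ?_
  obtain ⟨z, hz⟩ := hQ.gets_in h hh
  rcases le_total 0 (ρ z).toAdd with hpos | hneg
  · by_contra hhQ
    refine hstrict ⟨hQ, z, ?_, fun hsubset => ?_⟩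
    · rintro _ ⟨q, hq, rfl⟩
      exact hQ.stays z hpos q hq
    · obtain ⟨q, hq, hqh⟩ := hsubset hz
      have : q = h := by simpa using hqh
      exact hhQ (this ▸ hq)
  · have := hQ.stays z⁻¹ (by rw [map_inv, toAdd_inv]; linarith) _ hz
    simpa [mul_assoc] using this

variable {Q : Subgroup G}

theorem mem_kerIn {g : G} : g ∈ kerIn ρ ↔ ∃ z : Z, ρ z = 1 ∧ (z : G) = g :=
  Iff.rfl

theorem IsConfining.kerIn_le_normalizer (hQ : IsConfining H Z ρ (Q : Set G)) :
    kerIn ρ ≤ Subgroup.normalizer (Q : Set G) := by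
  rw [Subgroup.le_normalizer_iff]
  rintro _ ⟨z, hz, rfl⟩ q hq
  have := hQ.stays z⁻¹ (by rw [map_inv, MonoidHom.mem_ker.1 hz]; simp) q hq
  rwa [Subgroup.coe_inv, inv_inv] at this

theorem IsConfining.coe_sup_kerIn (hQ : IsConfining H Z ρ (Q : Set G)) :
    ((Q ⊔ kerIn ρ : Subgroup G) : Set G) = (Q : Set G) * (kerIn ρ : Set G) :=
  Subgroup.coe_mul_of_right_le_normalizer_left _ _ hQ.kerIn_le_normalizer

theorem IsConfining.mem_sup_kerIn (hQ : IsConfining H Z ρ (Q : Set G)) {g : G} :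
    g ∈ Q ⊔ kerIn ρ ↔ ∃ q ∈ Q, ∃ z : Z, ρ z = 1 ∧ q * z = g := by
  rw [← SetLike.mem_coe, hQ.coe_sup_kerIn, Set.mem_mul]
  simp only [SetLike.mem_coe, mem_kerIn]
  constructor
  · rintro ⟨q, hq, _, ⟨z, hz, rfl⟩, rfl⟩
    exact ⟨q, hq, z, hz, rfl⟩
  · rintro ⟨q, hq, z, hz, rfl⟩
    exact ⟨q, hq, z, ⟨z, hz, rfl⟩, rfl⟩

theorem IsConfining.mem_of_mem_sup_kerIn (hQ : IsConfining H Z ρ (Q : Set G))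
    (hHZ : Disjoint H Z) {g : G} (hg : g ∈ Q ⊔ kerIn ρ) (hgH : g ∈ H) : g ∈ Q := by
  obtain ⟨q, hq, z, -, rfl⟩ := hQ.mem_sup_kerIn.1 hg
  have hz : (z : G) = 1 := Subgroup.disjoint_def.1 hHZ
    ((mul_mem_cancel_left (hQ.subset hq)).1 hgH) z.2
  simpa [hz] using hq

variable {a : Z}

theorem IsConfining.conj_mem_sup_kerIn (hQ : IsConfining H Z ρ (Q : Set G))
    (ha : 0 ≤ (ρ a).toAdd) {k : G} (hk : k ∈ Q ⊔ kerIn ρ) :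
    (a : G)⁻¹ * k * a ∈ Q ⊔ kerIn ρ := by
  rw [hQ.mem_sup_kerIn] at hk ⊢
  obtain ⟨q, hq, z, hz, rfl⟩ := hk
  refine ⟨_, hQ.stays a ha q hq, a⁻¹ * z * a, by simp [hz], ?_⟩
  push_cast
  group

theorem IsConfining.exists_pow_conj_mem (hQ : IsConfining H Z ρ (Q : Set G))
    (ha : 0 < (ρ a).toAdd) {h : G} (hh : h ∈ H) : ∃ i : ℕ, ((a : G) ^ i)⁻¹ * h * a ^ i ∈ Q := by
  obtain ⟨y, hy⟩ := hQ.gets_in h hh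
  obtain ⟨i, hi⟩ := exists_nat_ge ((ρ y).toAdd / (ρ a).toAdd)
  refine ⟨i, ?_⟩
  have nonneg : 0 ≤ (ρ (y⁻¹ * a ^ i)).toAdd := by
    rw [div_le_iff₀ ha] at hi
    rw [map_mul, map_inv, map_pow, toAdd_mul, toAdd_inv, toAdd_pow, nsmul_eq_mul]
    linarith
  have conj_eq : ((a : G) ^ i)⁻¹ * h * a ^ i =
      ((y⁻¹ * a ^ i : Z) : G)⁻¹ * ((y : G)⁻¹ * h * y) * ((y⁻¹ * a ^ i : Z) : G) := by
    push_cast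
    group
  exact conj_eq ▸ hQ.stays _ nonneg _ hy

theorem IsConfining.exists_pow_mul_mul_pow_mem (hQ : IsConfining H Z ρ (Q : Set G))
    (hHZ : H ⊔ Z = ⊤) (ha : IsMinimalPositive ρ a) (g : G) :
    ∃ i j : ℕ, ((a : G) ^ i)⁻¹ * g * (a : G) ^ j ∈ Q ⊔ kerIn ρ := by
  have conj_mem : ∀ k ∈ Q ⊔ kerIn ρ, (a : G)⁻¹ * k * a ∈ Q ⊔ kerIn ρ :=
    fun _ => hQ.conj_mem_sup_kerIn ha.1.le
  suffices ascendingHull (Q ⊔ kerIn ρ) (a : G) conj_mem = ⊤ from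
    (mem_ascendingHull conj_mem).1 (this ▸ Subgroup.mem_top g)
  rw [eq_top_iff, ← hHZ, sup_le_iff]
  constructor
  · intro h hh
    obtain ⟨i, hi⟩ := hQ.exists_pow_conj_mem ha.1 hh
    exact ⟨i, i, Subgroup.mem_sup_left hi⟩
  · intro z hz
    obtain ⟨k, hk⟩ := ha.exists_zpow_eq ⟨z, hz⟩
    have ker_mem : ((a : G) ^ k)⁻¹ * z ∈ kerIn ρ :=
      mem_kerIn.2 ⟨(a ^ k)⁻¹ * ⟨z, hz⟩, by simp [hk], by simp⟩
    rw [← mul_inv_cancel_left ((a : G) ^ k) z]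
    exact mul_mem (zpow_mem (self_mem_ascendingHull conj_mem) k)
      (le_ascendingHull conj_mem (Subgroup.mem_sup_right ker_mem))

variable {χ : G →* Multiplicative ℤ}

theorem IsMinimalPositive.map_height (ha : IsMinimalPositive ρ a)
    (hρ : ∀ z : Z, (ρ z).toAdd = (ρ a).toAdd * (χ z).toAdd) :
    χ a = Multiplicative.ofAdd 1 := by
  have := hρ a
  rw [eq_comm, mul_eq_left₀ ha.1.ne'] at this
  exact Multiplicative.toAdd.injective (by exact_mod_cast this)

theorem IsMinimalPositive.map_eq_one_iff (ha : IsMinimalPositive ρ a)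
    (hρ : ∀ z : Z, (ρ z).toAdd = (ρ a).toAdd * (χ z).toAdd) (z : Z) : ρ z = 1 ↔ χ z = 1 := by
  rw [← toAdd_eq_zero, ← toAdd_eq_zero, hρ, mul_eq_zero, or_iff_right ha.1.ne', Int.cast_eq_zero]

theorem IsConfining.isAscending (hQ : IsConfining H Z ρ (Q : Set G)) (hHZ : H ⊔ Z = ⊤)
    (ha : IsMinimalPositive ρ a) (hH : H ≤ χ.ker)
    (hρ : ∀ z : Z, (ρ z).toAdd = (ρ a).toAdd * (χ z).toAdd) :
    IsAscending (Q ⊔ kerIn ρ) (a : G) χ where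
  conj_mem _ := hQ.conj_mem_sup_kerIn ha.1.le
  absorbs := hQ.exists_pow_mul_mul_pow_mem hHZ ha
  le_ker := sup_le (hQ.subset.trans hH) <| by
    rintro _ ⟨z, hz, rfl⟩
    exact (ha.map_eq_one_iff hρ z).1 hz
  map_stable := ha.map_height hρ

theorem IsConfining.isAxial_bassSerreAction (hQ : IsConfining H Z ρ (Q : Set G))
    (hHZ : H ⊔ Z = ⊤) (ha : IsMinimalPositive ρ a) (hH : H ≤ χ.ker)
    (hρ : ∀ z : Z, (ρ z).toAdd = (ρ a).toAdd * (χ z).toAdd) :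
    IsAxial Z (bassSerreAction (Q ⊔ kerIn ρ) (a : G))
      (bassSerreParent (hQ.isAscending hHZ ha hH hρ).conj_mem)
      (bassSerreHeight (hQ.isAscending hHZ ha hH hρ).le_ker) χ
      ((1 : G) : G ⧸ (Q ⊔ kerIn ρ)) where
  toFixesEnd := (hQ.isAscending hHZ ha hH hρ).fixesEnd
  axis z hz k hk := by
    rw [bassSerreParent_iterate_mk, bassSerreAction_mk, mul_one, one_mul, eq_comm,
      QuotientGroup.eq]
    refine Subgroup.mem_sup_right (mem_kerIn.2 ⟨(a ^ k)⁻¹ * ⟨z, hz⟩, ?_, by simp⟩)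
    rw [ha.map_eq_one_iff hρ, ← toAdd_eq_zero]
    push_cast
    rw [map_mul, map_inv, map_pow, ha.map_height hρ, toAdd_mul, hk]
    simp

theorem IsConfining.vertexStabilizer_bassSerreAction (hQ : IsConfining H Z ρ (Q : Set G))
    (hHZ : Disjoint H Z) (g : G) :
    vertexStabilizer (bassSerreAction (Q ⊔ kerIn ρ) g) H ((1 : G) : G ⧸ (Q ⊔ kerIn ρ)) = Q := by
  ext h
  change h ∈ H ∧ ((h * 1 : G) : G ⧸ (Q ⊔ kerIn ρ)) = ((1 : G) : G ⧸ (Q ⊔ kerIn ρ)) ↔ h ∈ Q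
  rw [mul_one, eq_comm, QuotientGroup.eq, inv_one, one_mul]
  exact ⟨fun ⟨hH, hK⟩ => hQ.mem_of_mem_sup_kerIn hHZ hK hH,
    fun hhQ => ⟨hQ.subset hhQ, Subgroup.mem_sup_left hhQ⟩⟩

theorem IsConfining.isAscendingHNN_isTree_isRepresentedBy [H.Normal]
    (hQ : IsConfining H Z ρ (Q : Set G)) (hHZ : H.IsComplement' Z)
    (ha : IsMinimalPositive ρ a) :
    IsAscendingHNN (Q ⊔ kerIn ρ) (a : G) ∧ (bassSerre (Q ⊔ kerIn ρ) (a : G)).IsTree ∧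
      ∀ e : Z, 0 < (ρ e).toAdd → IsRepresentedBy ((Q : Set G) ∪ slab ρ (ρ e).toAdd)
        (bassSerreAction (Q ⊔ kerIn ρ) (a : G)) := by
  obtain ⟨χ, hH, hρ⟩ := ha.exists_height hHZ
  have ascending := hQ.isAscending hHZ.sup_eq_top ha hH hρ
  refine ⟨ascending.isAscendingHNN, ascending.isRootedAtEnd.isTree, fun e he => ?_⟩
  have represented := (hQ.isAxial_bassSerreAction hHZ.sup_eq_top ha hH
    hρ).isRepresentedBy_union_slab hH hHZ.sup_eq_top isCobounded_bassSerreAction ha.1 hρ he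
  rw [hQ.vertexStabilizer_bassSerreAction hHZ.disjoint] at represented
  exact represented.1

end Confining

/-! ### Gromov products and coconvergence -/

section GromovProduct

variable {V : Type*} {Γ : SimpleGraph V}

theorem gromovProduct_le_dist_left (hΓ : Γ.Connected) (o x y : V) :
    gromovProduct Γ o x y ≤ Γ.dist o x := by
  have triangle : (Γ.dist o y : ℝ) ≤ Γ.dist o x + Γ.dist x y := mod_cast hΓ.dist_triangle
  rw [gromovProduct]
  linarith

theorem gromovProduct_le_add (hΓ : Γ.Connected) (o o' x x' y y' : V) :
    gromovProduct Γ o x y ≤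
      gromovProduct Γ o' x' y' + (Γ.dist o o' + Γ.dist x x' + Γ.dist y y') := by
  have triangle (a b c : V) : (Γ.dist a c : ℝ) ≤ Γ.dist a b + Γ.dist b c :=
    mod_cast hΓ.dist_triangle
  have comm (a b : V) : (Γ.dist a b : ℝ) = Γ.dist b a := by rw [Γ.dist_comm]
  have hox : (Γ.dist o x : ℝ) ≤ Γ.dist o o' + Γ.dist o' x' + Γ.dist x x' := by
    linarith [triangle o o' x, triangle o' x' x, comm x' x]
  have hoy : (Γ.dist o y : ℝ) ≤ Γ.dist o o' + Γ.dist o' y' + Γ.dist y y' := by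
    linarith [triangle o o' y, triangle o' y' y, comm y' y]
  have hxy : (Γ.dist x' y' : ℝ) ≤ Γ.dist x x' + Γ.dist x y + Γ.dist y y' := by
    linarith [triangle x' x y', triangle x y y', comm x' x]
  simp only [gromovProduct]
  linarith

theorem tendsto_gromovProduct_of_dist_le (hΓ : Γ.Connected) {x y x' y' : ℕ → V} {o o' : V} {D : ℕ}
    (hx : ∀ n, Γ.dist (x n) (x' n) ≤ D) (hy : ∀ n, Γ.dist (y n) (y' n) ≤ D)
    (h : Tendsto (fun p : ℕ × ℕ => gromovProduct Γ o (x p.1) (y p.2)) atTop atTop) :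
    Tendsto (fun p : ℕ × ℕ => gromovProduct Γ o' (x' p.1) (y' p.2)) atTop atTop := by
  refine tendsto_atTop_mono (fun p => ?_)
    (tendsto_atTop_add_const_right _ (-(Γ.dist o o' + D + D : ℝ)) h)
  have le_add := gromovProduct_le_add hΓ o o' (x p.1) (x' p.1) (y p.2) (y' p.2)
  have dist_x_le : (Γ.dist (x p.1) (x' p.1) : ℝ) ≤ D := mod_cast hx p.1
  have dist_y_le : (Γ.dist (y p.2) (y' p.2) : ℝ) ≤ D := mod_cast hy p.2
  linarith

theorem coConverge_of_dist_le (hΓ : Γ.Connected) {x y x' y' : ℕ → V} {D : ℕ}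
    (hx : ∀ n, Γ.dist (x n) (x' n) ≤ D) (hy : ∀ n, Γ.dist (y n) (y' n) ≤ D)
    (h : CoConverge Γ x y) : CoConverge Γ x' y' := fun o =>
  tendsto_gromovProduct_of_dist_le hΓ hx hy (h o)

theorem coConverge_of_tendsto (hΓ : Γ.Connected) {x y : ℕ → V} {o : V}
    (h : Tendsto (fun p : ℕ × ℕ => gromovProduct Γ o (x p.1) (y p.2)) atTop atTop) :
    CoConverge Γ x y := fun _ =>
  tendsto_gromovProduct_of_dist_le hΓ (D := 0) (by simp) (by simp) h

end GromovProduct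

/-! ### Ends of trees -/

section Tree

variable {V : Type*} {Γ : SimpleGraph V}

/-- `u` is a neighbour of `v` that is closer to `x`. In a tree it is the vertex that follows `v` on
the path from `v` to `x`. -/
def IsCloser (Γ : SimpleGraph V) (x v u : V) : Prop :=
  Γ.Adj v u ∧ Γ.dist u x + 1 = Γ.dist v x

theorem IsCloser.map {x v u : V} (e : Γ ≃g Γ) (h : IsCloser Γ x v u) :
    IsCloser Γ (e x) (e v) (e u) :=
  ⟨e.map_adj_iff.2 h.1, by simpa only [dist_iso] using h.2⟩

theorem exists_isCloser (hΓ : Γ.Connected) {x v : V} (hvx : v ≠ x) : ∃ u, IsCloser Γ x v u := by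
  obtain ⟨p, hp⟩ := hΓ.exists_walk_length_eq_dist v x
  cases p with
  | nil => exact absurd rfl hvx
  | @cons _ u _ hadj p =>
    rw [SimpleGraph.Walk.length_cons] at hp
    have tail_le := SimpleGraph.dist_le p
    have triangle := hΓ.dist_triangle (u := v) (v := u) (w := x)
    rw [SimpleGraph.dist_eq_one_iff_adj.2 hadj] at triangle
    exact ⟨u, hadj, by lia⟩

theorem IsCloser.exists_isPath (hΓ : Γ.Connected) {x v u : V} (h : IsCloser Γ x v u) :
    ∃ p : Γ.Walk v x, p.IsPath ∧ p.snd = u := by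
  obtain ⟨p, hp⟩ := hΓ.exists_walk_length_eq_dist u x
  refine ⟨.cons h.1 p, SimpleGraph.Walk.isPath_of_length_eq_dist _ ?_, by simp⟩
  rw [SimpleGraph.Walk.length_cons, hp, h.2]

theorem IsCloser.unique (hΓ : Γ.IsTree) {x v u u' : V} (h : IsCloser Γ x v u)
    (h' : IsCloser Γ x v u') : u = u' := by
  obtain ⟨p, hp, rfl⟩ := h.exists_isPath hΓ.connected
  obtain ⟨q, hq, rfl⟩ := h'.exists_isPath hΓ.connected
  rw [(hΓ.existsUnique_path v x).unique hp hq]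

theorem isCloser_or_isCloser_of_adj (hΓ : Γ.IsTree) (x : V) {v u : V} (hvu : Γ.Adj v u) :
    IsCloser Γ x v u ∨ IsCloser Γ x u v := by
  have := hΓ.dist_eq_dist_add_one_of_adj x hvu
  rw [Γ.dist_comm (u := x), Γ.dist_comm (u := x)] at this
  exact this.imp (fun h => ⟨hvu, h.symm⟩) fun h => ⟨hvu.symm, h.symm⟩

theorem dist_eq_add_of_isCloser (hΓ : Γ.IsTree) {x y v u : V} (hx : IsCloser Γ x v u)
    (hy : IsCloser Γ y u v) : Γ.dist x y = Γ.dist v x + Γ.dist v y := by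
  induction hn : Γ.dist u x generalizing v u with
  | zero =>
    obtain rfl : u = x := hΓ.connected.dist_eq_zero_iff.1 hn
    rw [← hy.2, ← hx.2, hn]
    lia
  | succ n ih =>
    have hux : u ≠ x := by
      rintro rfl
      simp at hn
    obtain ⟨u', hu'⟩ := exists_isCloser hΓ.connected hux
    have dist_u' := hu'.2
    have dist_u := hx.2
    have hyu : IsCloser Γ y u' u := by
      refine (isCloser_or_isCloser_of_adj hΓ y hu'.1).resolve_left fun h => ?_
      obtain rfl : u' = v := h.unique hΓ hy
      lia
    rw [ih hu' hyu (by lia), ← dist_u, ← hy.2]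
    lia

theorem exists_isCloser_of_one_le_gromovProduct (hΓ : Γ.IsTree) {x y v : V}
    (h : 1 ≤ gromovProduct Γ v x y) : ∃ u, IsCloser Γ x v u ∧ IsCloser Γ y v u := by
  have hvx : v ≠ x := by
    rintro rfl
    have := gromovProduct_le_dist_left hΓ.connected v v y
    rw [SimpleGraph.dist_self, Nat.cast_zero] at this
    linarith
  obtain ⟨u, hu⟩ := exists_isCloser hΓ.connected hvx
  refine ⟨u, hu, (isCloser_or_isCloser_of_adj hΓ y hu.1).resolve_right fun hy => ?_⟩
  rw [gromovProduct, dist_eq_add_of_isCloser hΓ hu hy, Nat.cast_add, sub_self, zero_div] at h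
  linarith

theorem CoConverge.exists_isCloser (hΓ : Γ.IsTree) {x y : ℕ → V} (h : CoConverge Γ x y) (v : V) :
    ∃ u, (∀ᶠ n in atTop, IsCloser Γ (x n) v u) ∧ ∀ᶠ n in atTop, IsCloser Γ (y n) v u := by
  obtain ⟨N, hN⟩ := eventually_atTop_prod_self.1 ((h v).eventually_ge_atTop 1)
  have common (m n : ℕ) (hm : N ≤ m) (hn : N ≤ n) :=
    exists_isCloser_of_one_le_gromovProduct hΓ (hN m n hm hn)
  obtain ⟨u, hxN, hyN⟩ := common N N le_rfl le_rfl
  refine ⟨u, ?_, ?_⟩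
  · filter_upwards [eventually_ge_atTop N] with n hn
    obtain ⟨u', hx, hy⟩ := common n N hn le_rfl
    exact hy.unique hΓ hyN ▸ hx
  · filter_upwards [eventually_ge_atTop N] with n hn
    obtain ⟨u', hx, hy⟩ := common N n le_rfl hn
    exact hx.unique hΓ hxN ▸ hy

/-- The neighbour of `v` in the direction of the limit of the sequence `x`; it is a meaningful
choice only if `x` converges to a point at infinity of a tree. -/
noncomputable def seqParent (Γ : SimpleGraph V) (x : ℕ → V) (v : V) : V :=
  @Classical.epsilon V ⟨v⟩ fun u => ∀ᶠ n in atTop, IsCloser Γ (x n) v u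

theorem eventually_isCloser_seqParent (hΓ : Γ.IsTree) {x : ℕ → V} (h : CoConverge Γ x x) (v : V) :
    ∀ᶠ n in atTop, IsCloser Γ (x n) v (seqParent Γ x v) :=
  let ⟨u, hu, _⟩ := h.exists_isCloser hΓ v
  Classical.epsilon_spec (p := fun u => ∀ᶠ n in atTop, IsCloser Γ (x n) v u) ⟨u, hu⟩

theorem seqParent_eq (hΓ : Γ.IsTree) {x : ℕ → V} {v u : V}
    (hu : ∀ᶠ n in atTop, IsCloser Γ (x n) v u) : seqParent Γ x v = u := by
  have spec := Classical.epsilon_spec (p := fun u => ∀ᶠ n in atTop, IsCloser Γ (x n) v u) ⟨u, hu⟩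
  obtain ⟨n, hparent, hu⟩ := (spec.and hu).exists
  exact hparent.unique hΓ hu

/-- The parent function of a tree that moves every vertex one step towards the end `ξ`. -/
noncomputable def Boundary.parent (hΓ : Γ.IsTree) (ξ : Boundary Γ) : V → V :=
  Quot.lift (fun x : GromovSeq Γ => seqParent Γ x.1) (fun _ _ h => by
    funext v
    obtain ⟨u, hx, hy⟩ := CoConverge.exists_isCloser hΓ h v
    rw [seqParent_eq hΓ hx, seqParent_eq hΓ hy]) ξ

theorem Boundary.parent_boundaryMap (hΓ : Γ.IsTree) (e : Γ ≃g Γ) (ξ : Boundary Γ) (v : V) :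
    (boundaryMap e ξ).parent hΓ (e v) = e (ξ.parent hΓ v) := by
  obtain ⟨x, rfl⟩ := Quot.exists_rep ξ
  exact seqParent_eq hΓ ((eventually_isCloser_seqParent hΓ x.2 v).mono fun _ hn => hn.map e)

theorem FixesPoint.map_parent {G : Type*} [Group G] {α : G →* (Γ ≃g Γ)} {ξ : Boundary Γ}
    (h : FixesPoint α ξ) (hΓ : Γ.IsTree) (g : G) (v : V) :
    α g (ξ.parent hΓ v) = ξ.parent hΓ (α g v) := by
  rw [← Boundary.parent_boundaryMap, h g]

namespace ConvergesTo

variable {x : ℕ → V} {ξ : Boundary Γ}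

theorem eventually_isCloser_parent (h : ConvergesTo x ξ) (hΓ : Γ.IsTree) (v : V) :
    ∀ᶠ n in atTop, IsCloser Γ (x n) v (ξ.parent hΓ v) := by
  obtain ⟨hx, rfl⟩ := h
  exact eventually_isCloser_seqParent hΓ hx v

theorem parent_eq (h : ConvergesTo x ξ) (hΓ : Γ.IsTree) {v u : V}
    (hu : ∀ᶠ n in atTop, IsCloser Γ (x n) v u) : ξ.parent hΓ v = u :=
  let ⟨_, hparent, hu⟩ := ((h.eventually_isCloser_parent hΓ v).and hu).exists
  hparent.unique hΓ hu

theorem adj_parent (h : ConvergesTo x ξ) (hΓ : Γ.IsTree) (v : V) : Γ.Adj v (ξ.parent hΓ v) :=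
  let ⟨_, hn⟩ := (h.eventually_isCloser_parent hΓ v).exists
  hn.1

theorem parent_eq_or_of_adj (h : ConvergesTo x ξ) (hΓ : Γ.IsTree) {u v : V} (huv : Γ.Adj u v) :
    ξ.parent hΓ u = v ∨ ξ.parent hΓ v = u := by
  obtain ⟨n, hu, hv⟩ :=
    ((h.eventually_isCloser_parent hΓ u).and (h.eventually_isCloser_parent hΓ v)).exists
  exact (isCloser_or_isCloser_of_adj hΓ (x n) huv).imp (hu.unique hΓ) (hv.unique hΓ)

theorem exists_iterate_parent_eq (h : ConvergesTo x ξ) (hΓ : Γ.IsTree) (u v : V) :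
    ∃ i j : ℕ, (ξ.parent hΓ)^[i] u = (ξ.parent hΓ)^[j] v := by
  obtain ⟨p⟩ := hΓ.connected.preconnected u v
  obtain ⟨i, j, hij, -⟩ :=
    exists_iterate_eq_of_walk (fun _ _ => h.parent_eq_or_of_adj hΓ) p
  exact ⟨i, j, hij⟩

theorem eventually_dist_iterate_parent (h : ConvergesTo x ξ) (hΓ : Γ.IsTree) (i : ℕ) (v : V) :
    ∀ᶠ n in atTop, Γ.dist ((ξ.parent hΓ)^[i] v) (x n) + i = Γ.dist v (x n) := by
  induction i with
  | zero => simp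
  | succ i ih =>
    filter_upwards [ih, h.eventually_isCloser_parent hΓ ((ξ.parent hΓ)^[i] v)] with n hn hcloser
    rw [Function.iterate_succ_apply', ← hn, ← hcloser.2]
    lia

theorem exists_eventually_eq_dist_sub_dist (h : ConvergesTo x ξ) (hΓ : Γ.IsTree) (o v : V) :
    ∃ k : ℤ, ∀ᶠ n in atTop, k = (Γ.dist o (x n) : ℤ) - Γ.dist v (x n) := by
  obtain ⟨i, j, hij⟩ := h.exists_iterate_parent_eq hΓ o v
  refine ⟨i - j, ?_⟩
  filter_upwards [h.eventually_dist_iterate_parent hΓ i o,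
    h.eventually_dist_iterate_parent hΓ j v] with n ho hv
  rw [hij] at ho
  lia

theorem exists_isRootedAtEnd (h : ConvergesTo x ξ) (hΓ : Γ.IsTree) (o : V) :
    ∃ ht : V → ℤ, IsRootedAtEnd Γ (ξ.parent hΓ) ht ∧
      ∀ v, ∀ᶠ n in atTop, ht v = (Γ.dist o (x n) : ℤ) - Γ.dist v (x n) := by
  choose ht hht using h.exists_eventually_eq_dist_sub_dist hΓ o
  refine ⟨ht, ⟨fun u v => ⟨h.parent_eq_or_of_adj hΓ, ?_⟩, fun v => ?_,
    h.exists_iterate_parent_eq hΓ⟩, hht⟩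
  · rintro (rfl | rfl)
    exacts [h.adj_parent hΓ u, (h.adj_parent hΓ v).symm]
  · obtain ⟨n, ⟨hv, hparent⟩, -, hcloser⟩ :=
      (((hht v).and (hht _)).and (h.eventually_isCloser_parent hΓ v)).exists
    rw [hv, hparent, ← hcloser]
    push_cast
    ring

end ConvergesTo

end Tree

/-! ### The Busemann character of a fixed end -/

theorem homogenization_eq_of_forall_pow {G : Type*} [Group G] {q : G → ℝ} {g : G}
    (hq : ∀ n : ℕ, q (g ^ n) = n * q g) : homogenization q g = q g := by
  refine Tendsto.limUnder_eq (tendsto_const_nhds.congr' ?_)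
  filter_upwards [eventually_ne_atTop 0] with n hn
  rw [hq, mul_div_cancel_left₀ _ (Nat.cast_ne_zero.2 hn)]

section Busemann

variable {G V : Type*} [Group G] {Γ : SimpleGraph V} {α : G →* (Γ ≃g Γ)} {P : V → V}
  {ht : V → ℤ} {χ : G →* Multiplicative ℤ}

theorem IsRootedAtEnd.ht_map_sub_ht (h : IsRootedAtEnd Γ P ht) {f : V → V}
    (hf : Function.Commute f P) (u v : V) : ht (f u) - ht u = ht (f v) - ht v := by
  have shift (k : ℕ) (v : V) : ht (f (P^[k] v)) = ht (f v) + k := by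
    rw [hf.iterate_right k v, h.ht_iterate]
  obtain ⟨i, j, hij⟩ := h.exists_iterate_eq u v
  have ht_eq := congrArg ht hij
  have ht_map_eq := congrArg (ht ∘ f) hij
  simp only [Function.comp_apply, shift, h.ht_iterate] at ht_eq ht_map_eq
  lia

theorem IsRootedAtEnd.exists_fixesEnd [Nonempty V] (h : IsRootedAtEnd Γ P ht)
    (hP : ∀ g v, α g (P v) = P (α g v)) : ∃ χ : G →* Multiplicative ℤ, FixesEnd α P ht χ := by
  obtain ⟨o⟩ := ‹Nonempty V›
  have ht_map (g : G) (v : V) : ht (α g v) = ht v + (ht (α g o) - ht o) := by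
    rw [h.ht_map_sub_ht (hP g) o v]
    lia
  refine ⟨MonoidHom.mk' (fun g => .ofAdd (ht (α g o) - ht o)) fun g g' => ?_, h, hP, ht_map⟩
  rw [← ofAdd_add, map_mul, RelIso.mul_apply, ht_map g (α g' o)]
  congr 1
  ring

namespace FixesEnd

theorem busemann_eq (h : FixesEnd α P ht χ) {x : V} {xs : ℕ → V}
    (hht : ∀ v, ∀ᶠ n in atTop, ht v = (Γ.dist x (xs n) : ℤ) - Γ.dist v (xs n)) (g : G) :
    busemann α x xs g = (χ g).toAdd := by
  have hx : ht x = 0 := by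
    obtain ⟨n, hn⟩ := (hht x).exists
    rw [hn, sub_self]
  have quasimorphism_eq (g : G) : busemannQuasimorphism α x xs g = (χ g).toAdd := by
    refine Tendsto.limsup_eq (tendsto_const_nhds.congr' ?_)
    filter_upwards [hht (α g x)] with n hn
    rw [h.ht_map, hx, zero_add] at hn
    exact_mod_cast congrArg (Int.cast (R := ℝ)) hn
  rw [busemann, homogenization_eq_of_forall_pow fun n => ?_, quasimorphism_eq]
  simp [quasimorphism_eq]

theorem ne_one (h : FixesEnd α P ht χ) (hα : IsCobounded α) : χ ≠ 1 := by
  rintro rfl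
  obtain ⟨x, R, hR⟩ := hα
  obtain ⟨g, hg⟩ := hR (P^[R + 1] x)
  have ht_diff := h.abs_ht_sub_le_dist (α g x) (P^[R + 1] x)
  rw [h.ht_map, h.ht_iterate, MonoidHom.one_apply, toAdd_one, abs_le] at ht_diff
  lia

theorem exists_pos (h : FixesEnd α P ht χ) (hα : IsCobounded α) {H Z : Subgroup G}
    (hH : H ≤ χ.ker) (hHZ : H ⊔ Z = ⊤) : ∃ b ∈ Z, 0 < (χ b).toAdd := by
  by_contra! hZ
  have hZ' : Z ≤ χ.ker := fun z hz => by
    have nonpos := hZ z hz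
    have nonneg := hZ z⁻¹ (inv_mem hz)
    rw [map_inv, toAdd_inv] at nonneg
    exact Multiplicative.toAdd.injective (show (χ z).toAdd = 0 by lia)
  exact h.ne_one hα (MonoidHom.ker_eq_top_iff.1 (top_le_iff.1 (hHZ ▸ sup_le hH hZ')))

/-! ### Axes of commuting translations -/

theorem exists_map_eq_iterate (h : FixesEnd α P ht χ) {b : G} {m : ℕ} (hb : (χ b).toAdd = m)
    (x : V) : ∃ w, α b w = P^[m] w := by
  obtain ⟨i, j, hij⟩ := h.exists_iterate_eq x (α b x)
  have ht_eq := congrArg ht hij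
  rw [h.ht_iterate, h.ht_iterate, h.ht_map, hb] at ht_eq
  obtain rfl : i = m + j := by lia
  exact ⟨P^[j] x, by rw [h.map_iterate, ← hij, Function.iterate_add_apply]⟩

theorem map_pow_eq_iterate (h : FixesEnd α P ht χ) {b : G} {m : ℕ} {w : V}
    (hw : α b w = P^[m] w) (k : ℕ) : α (b ^ k) w = P^[m * k] w := by
  induction k with
  | zero => simp
  | succ k ih =>
    rw [pow_succ, map_mul, RelIso.mul_apply, hw, h.map_iterate, ih, ← Function.iterate_add_apply,
      mul_add_one, add_comm]

-- A large power of `b` pushes both `α z w` and `P^[k] w` above a common ancestor, where they agree.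
theorem map_eq_iterate_of_commute (h : FixesEnd α P ht χ) {b z : G} {m : ℕ} {w : V} (hm : 0 < m)
    (hw : α b w = P^[m] w) (hbz : Commute b z) {k : ℕ} (hk : (χ z).toAdd = k) :
    α z w = P^[k] w := by
  obtain ⟨i, j, hij⟩ := h.exists_iterate_eq (α z w) (P^[k] w)
  have ht_eq := congrArg ht hij
  rw [h.ht_iterate, h.ht_iterate, h.ht_iterate, h.ht_map, hk] at ht_eq
  obtain rfl : j = i := by lia
  obtain ⟨s, hs⟩ := Nat.exists_eq_add_of_le' (Nat.le_mul_of_pos_left j hm)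
  have hbj : α (b ^ j) w = P^[s] (P^[j] w) := by
    rw [h.map_pow_eq_iterate hw, hs, Function.iterate_add_apply]
  apply (α (b ^ j)).injective
  calc α (b ^ j) (α z w) = α z (α (b ^ j) w) := by
        rw [← RelIso.mul_apply, ← map_mul, (hbz.pow_left j).eq, map_mul, RelIso.mul_apply]
    _ = P^[s] (P^[j] (α z w)) := by rw [hbj, h.map_iterate, h.map_iterate]
    _ = P^[k] (P^[s] (P^[j] w)) := by
        simp only [hij, ← Function.iterate_add_apply]
        exact congrArg (P^[·] w) (by lia)
    _ = α (b ^ j) (P^[k] w) := by rw [h.map_iterate, hbj]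

theorem exists_isAxial (h : FixesEnd α P ht χ) {Z : Subgroup G} [IsMulCommutative Z] {b : G}
    (hb : b ∈ Z) (hχb : 0 < (χ b).toAdd) (x : V) : ∃ w, IsAxial Z α P ht χ w := by
  obtain ⟨m, hm⟩ := Int.eq_ofNat_of_zero_le hχb.le
  obtain ⟨w, hw⟩ := h.exists_map_eq_iterate hm x
  exact ⟨w, h, fun z hz k hk => h.map_eq_iterate_of_commute (by lia) hw
    (setLike_mul_comm hb hz) hk⟩

end FixesEnd

end Busemann

section BoundaryPoints

variable {V : Type*} {Γ : SimpleGraph V} {x y : ℕ → V} {ξ η : Boundary Γ}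

theorem ConvergesTo.eq_of_coConverge (hx : ConvergesTo x ξ) (hy : ConvergesTo y η)
    (hxy : CoConverge Γ x y) : ξ = η := by
  obtain ⟨hx, rfl⟩ := hx
  obtain ⟨hy, rfl⟩ := hy
  exact Quot.sound hxy

theorem ConvergesTo.of_dist_le (hx : ConvergesTo x ξ) (hΓ : Γ.Connected) {D : ℕ}
    (hxy : ∀ n, Γ.dist (x n) (y n) ≤ D) : ConvergesTo y ξ := by
  have hyy := coConverge_of_dist_le hΓ hxy hxy hx.choose
  have hxy' := coConverge_of_dist_le hΓ (x := x) (x' := x) (by simp) hxy hx.choose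
  exact ⟨hyy, (hx.eq_of_coConverge ⟨hyy, rfl⟩ hxy').symm⟩

end BoundaryPoints

/-! ### Limit points of axial actions -/

theorem min_unit_mul_le (s : ℤˣ) (a b : ℤ) :
    2 * min (s * a) (s * b) ≤ |a| + |b| - |a - b| := by
  rcases Int.units_eq_one_or s with rfl | rfl <;>
    simp only [abs_eq_max_neg, Units.val_one, Units.val_neg] <;> lia

theorem exists_unit_mul_pos {a : ℤ} (ha : a ≠ 0) : ∃ s : ℤˣ, 0 < s * a := by
  rcases lt_or_gt_of_ne ha with h | h
  exacts [⟨-1, by simpa using h⟩, ⟨1, by simpa using h⟩]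

theorem unit_mul_eq_abs {s : ℤˣ} {a b : ℤ} (hb : 0 < s * b) (h : 0 < |a| + |b| - |a - b|) :
    s * a = |a| := by
  rcases Int.units_eq_one_or s with rfl | rfl <;>
    simp only [abs_eq_max_neg, Units.val_one, Units.val_neg] at * <;> lia

section Axial

variable {G V : Type*} [Group G] {Γ : SimpleGraph V} {α : G →* (Γ ≃g Γ)} {P : V → V}
  {ht : V → ℤ} {χ : G →* Multiplicative ℤ} {H Z : Subgroup G} {w : V}

theorem FixesEnd.exists_fixes_iterate (h : FixesEnd α P ht χ) {x : G} (hx : χ x = 1) (v : V) :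
    ∃ i : ℕ, α x (P^[i] v) = P^[i] v := by
  obtain ⟨i, j, hij⟩ := h.exists_iterate_eq (α x v) v
  have ht_eq := congrArg ht hij
  rw [h.ht_iterate, h.ht_iterate, h.ht_map, hx, toAdd_one] at ht_eq
  obtain rfl : i = j := by lia
  exact ⟨i, by rw [h.map_iterate, hij]⟩

namespace IsAxial

theorem connected (h : IsAxial Z α P ht χ w) : Γ.Connected :=
  (SimpleGraph.connected_iff _).2 ⟨h.preconnected, ⟨w⟩⟩

theorem gromovProduct_map_map (h : IsAxial Z α P ht χ w) {z z' : G} (hz : z ∈ Z) (hz' : z' ∈ Z) :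
    2 * gromovProduct Γ w (α z w) (α z' w) =
      (|(χ z).toAdd| + |(χ z').toAdd| - |(χ z).toAdd - (χ z').toAdd| : ℤ) := by
  rw [← h.dist_map_map hz hz', ← h.dist_self_map hz, ← h.dist_self_map hz', gromovProduct]
  push_cast
  ring

variable {z z' : ℕ → G}

theorem coConverge_of_tendsto {s : ℤˣ} (h : IsAxial Z α P ht χ w) (hz : ∀ n, z n ∈ Z)
    (hz' : ∀ n, z' n ∈ Z) (hs : Tendsto (fun n => s * (χ (z n)).toAdd) atTop atTop)
    (hs' : Tendsto (fun n => s * (χ (z' n)).toAdd) atTop atTop) :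
    CoConverge Γ (fun n => α (z n) w) (fun n => α (z' n) w) := by
  have escape : Tendsto (fun p : ℕ × ℕ => min (s * (χ (z p.1)).toAdd) (s * (χ (z' p.2)).toAdd))
      atTop atTop := by
    rw [← prod_atTop_atTop_eq]
    exact tendsto_inf_atTop _ (hs.comp tendsto_fst) (hs'.comp tendsto_snd)
  refine ConfTree.coConverge_of_tendsto h.connected (o := w)
    (tendsto_atTop_mono (fun p => ?_) (tendsto_intCast_atTop_iff (R := ℝ).2 escape))
  rw [← mul_le_mul_iff_right₀ two_pos, h.gromovProduct_map_map (hz p.1) (hz' p.2)]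
  exact_mod_cast min_unit_mul_le s (χ (z p.1)).toAdd (χ (z' p.2)).toAdd

theorem exists_tendsto_of_coConverge (h : IsAxial Z α P ht χ w) (hz : ∀ n, z n ∈ Z)
    (hconv : CoConverge Γ (fun n => α (z n) w) (fun n => α (z n) w)) :
    ∃ s : ℤˣ, Tendsto (fun n => s * (χ (z n)).toAdd) atTop atTop := by
  obtain ⟨N, hN⟩ := eventually_atTop_prod_self.1 ((hconv w).eventually_gt_atTop 0)
  have overlap (i j : ℕ) (hi : N ≤ i) (hj : N ≤ j) : 0 < |(χ (z i)).toAdd| + |(χ (z j)).toAdd| -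
      |(χ (z i)).toAdd - (χ (z j)).toAdd| := by
    rw [← Int.cast_pos (R := ℝ), ← h.gromovProduct_map_map (hz i) (hz j)]
    exact mul_pos two_pos (hN i j hi hj)
  have ne_zero : (χ (z N)).toAdd ≠ 0 := fun h0 => by simpa [h0] using overlap N N le_rfl le_rfl
  obtain ⟨s, hs⟩ := exists_unit_mul_pos ne_zero
  refine ⟨s, tendsto_intCast_atTop_iff (R := ℝ).1
    (((hconv w).comp tendsto_atTop_diagonal).congr' ?_)⟩
  filter_upwards [eventually_ge_atTop N] with n hn
  have := h.gromovProduct_map_map (hz n) (hz n)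
  rw [unit_mul_eq_abs hs (overlap n N hn le_rfl)]
  rw [sub_self, abs_zero] at this
  push_cast at this
  simp only [Function.comp_apply, Int.cast_abs]
  linarith

theorem top [H.Normal] (h : IsAxial Z α P ht χ w) (hH : H ≤ χ.ker) (hHZ : H ⊔ Z = ⊤)
    (hfix : ∀ x ∈ H, α x w = w) : IsAxial ⊤ α P ht χ w where
  toFixesEnd := h.toFixesEnd
  axis g _ k hk := by
    obtain ⟨x, hx, z, hz, rfl⟩ := Subgroup.mem_sup_of_normal_left.1 (hHZ ▸ Subgroup.mem_top g)
    rw [map_mul, hH hx, one_mul] at hk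
    rw [map_mul, RelIso.mul_apply, h.axis z hz k hk, h.map_iterate, hfix x hx]

theorem limitSet_finite (h : IsAxial ⊤ α P ht χ w) : (limitSet α).Finite := by
  set side : ℤˣ → Set (Boundary Γ) := fun s =>
    {ξ | ∃ g : ℕ → G, Tendsto (fun n => s * (χ (g n)).toAdd) atTop atTop ∧
      ConvergesTo (fun n => α (g n) w) ξ}
  have side_subsingleton (s : ℤˣ) : (side s).Subsingleton := by
    rintro ξ ⟨g, hg, hξ⟩ η ⟨g', hg', hη⟩
    exact hξ.eq_of_coConverge hη
      (h.coConverge_of_tendsto (fun _ => trivial) (fun _ => trivial) hg hg')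
  refine (Set.finite_iUnion fun s => (side_subsingleton s).finite).subset ?_
  rintro ξ ⟨x, g, hconv⟩
  have hξ : ConvergesTo (fun n => α (g n) w) ξ :=
    hconv.of_dist_le h.connected (D := Γ.dist x w) fun n => (dist_iso _ _ _).le
  obtain ⟨s, hs⟩ := h.exists_tendsto_of_coConverge (fun _ => trivial) hξ.choose
  exact Set.mem_iUnion.2 ⟨s, g, hs, hξ⟩

theorem dist_iterate_map (h : IsAxial Z α P ht χ w) {z : G} (hz : z ∈ Z) {k : ℕ}
    (hk : (χ z).toAdd ≤ k) : (Γ.dist (P^[k] w) (α z w) : ℤ) = k - (χ z).toAdd := by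
  obtain ⟨j, hj⟩ := Int.le.dest hk
  rw [← h.iterate_map hz (i := k) (j := j) (by lia), Γ.dist_comm, h.dist_iterate]
  lia

theorem isCloser_iterate (h : IsAxial Z α P ht χ w) {z : G} (hz : z ∈ Z) {k : ℕ}
    (hk : (χ z).toAdd ≤ k) : IsCloser Γ (α z w) (P^[k + 1] w) (P^[k] w) := by
  have dist_k := h.dist_iterate_map hz hk
  have dist_succ := h.dist_iterate_map hz (k := k + 1) (by lia)
  refine ⟨?_, by lia⟩
  rw [Function.iterate_succ_apply']
  exact (h.adj_parent _).symm

-- The parent function towards the other end of the axis descends from any `P^[i] w` back to `w`.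
theorem map_eq_self_of_fixesPoint (h : IsAxial Z α P ht χ w) (hΓ : Γ.IsTree)
    (hz : ∀ n, z n ∈ Z) (hχ : ∀ n, (χ (z n)).toAdd ≤ 0) {η : Boundary Γ}
    (hη : ConvergesTo (fun n => α (z n) w) η) (hfix : FixesPoint α η) {x : G} (hx : χ x = 1) :
    α x w = w := by
  have descend (k : ℕ) : η.parent hΓ (P^[k + 1] w) = P^[k] w :=
    hη.parent_eq hΓ (.of_forall fun n => h.isCloser_iterate (hz n) (by linarith [hχ n]))
  have descend_iterate (i : ℕ) : (η.parent hΓ)^[i] (P^[i] w) = w := by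
    induction i with
    | zero => rfl
    | succ i ih => rw [Function.iterate_succ_apply, descend, ih]
  have commute : Function.Commute (α x) (η.parent hΓ) := hfix.map_parent hΓ x
  obtain ⟨i, hi⟩ := h.exists_fixes_iterate hx w
  rw [← descend_iterate i, commute.iterate_right i, hi]

theorem map_eq_self_of_isOrientedLineal (h : IsAxial Z α P ht χ w) (hΓ : Γ.IsTree)
    (hα : IsOrientedLineal α) {b : G} (hb : b ∈ Z) (hχb : 0 < (χ b).toAdd) {x : G}
    (hx : χ x = 1) : α x w = w := by
  have hz (n : ℕ) : b⁻¹ ^ n ∈ Z := pow_mem (inv_mem hb) n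
  have height (n : ℕ) : (χ (b⁻¹ ^ n)).toAdd = -(n * (χ b).toAdd) := by simp
  have escape : Tendsto (fun n : ℕ => ((-1 : ℤˣ) : ℤ) * (χ (b⁻¹ ^ n)).toAdd) atTop atTop := by
    simp only [height, Units.val_neg, Units.val_one, neg_mul_neg, one_mul]
    exact (tendsto_natCast_atTop_atTop (R := ℤ)).atTop_mul_const' hχb
  have hη : ConvergesTo (fun n => α (b⁻¹ ^ n) w) (Quot.mk _ ⟨_, _⟩) :=
    ⟨h.coConverge_of_tendsto hz hz escape escape, rfl⟩
  refine h.map_eq_self_of_fixesPoint hΓ hz (fun n => ?_) hη (hα.2 _ ⟨w, _, hη⟩) hx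
  rw [height]
  have := mul_nonneg (Int.natCast_nonneg n) hχb.le
  lia

/-! ### Vertex stabilizers of axial actions are confining -/

variable {ρ : Z →* Multiplicative ℝ} {r : ℝ} {e : Z}

theorem isConfining_vertexStabilizer [H.Normal] (h : IsAxial Z α P ht χ w) (hH : H ≤ χ.ker)
    (hr : 0 < r) (hρ : ∀ z : Z, (ρ z).toAdd = r * (χ z).toAdd) (he : 0 < (ρ e).toAdd) :
    IsConfining H Z ρ (vertexStabilizer α H w : Set G) where
  subset _ hq := hq.1
  symmetric _ hq := inv_mem (S := Subgroup G) hq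
  stays z hz q hq := by
    rw [hρ, mul_nonneg_iff_of_pos_left hr] at hz
    exact h.conj_mem_vertexStabilizer (i := 0) z.2 (mod_cast hz) hq.1 hq.2
  gets_in x hx := by
    rw [hρ, mul_pos_iff_of_pos_left hr] at he
    obtain ⟨i, hi⟩ := h.exists_fixes_iterate (hH hx) w
    refine ⟨e ^ i, h.conj_mem_vertexStabilizer (e ^ i).2 ?_ hx hi⟩
    rw [Subgroup.coe_pow, map_pow, toAdd_pow, nsmul_eq_mul]
    exact le_mul_of_one_le_right (Int.natCast_nonneg i) (mod_cast he)
  products := ⟨1, fun q hq r hr => by simpa using mul_mem (S := Subgroup G) hq hr⟩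

theorem isStrictlyConfining_vertexStabilizer [H.Normal] (h : IsAxial Z α P ht χ w)
    (hH : H ≤ χ.ker) (hHZ : H ⊔ Z = ⊤) (hr : 0 < r)
    (hρ : ∀ z : Z, (ρ z).toAdd = r * (χ z).toAdd) (he : 0 < (ρ e).toAdd)
    (hα : IsQuasiParabolic α) :
    IsStrictlyConfining H Z ρ (vertexStabilizer α H w : Set G) := by
  by_contra hstrict
  have eq_H := (h.isConfining_vertexStabilizer hH hr hρ he).eq_of_not_isStrictlyConfining hstrict
  exact hα.1 (h.top hH hHZ fun x hx => (eq_H.ge hx).2).limitSet_finite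

theorem vertexStabilizer_eq_of_isOrientedLineal (h : IsAxial Z α P ht χ w) (hΓ : Γ.IsTree)
    (hα : IsOrientedLineal α) (hH : H ≤ χ.ker) {b : G} (hb : b ∈ Z) (hχb : 0 < (χ b).toAdd) :
    vertexStabilizer α H w = H :=
  le_antisymm (fun _ hx => hx.1) fun _ hx =>
    ⟨hx, h.map_eq_self_of_isOrientedLineal hΓ hα hb hχb (hH hx)⟩

end IsAxial

end Axial

theorem FixesPoint.exists_fixesEnd {G V : Type*} [Group G] {Γ : SimpleGraph V}
    {α : G →* (Γ ≃g Γ)} {ξ : Boundary Γ} {xs : ℕ → V} (hξ : FixesPoint α ξ)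
    (hxs : ConvergesTo xs ξ) (hΓ : Γ.IsTree) (x : V) :
    ∃ P ht χ, FixesEnd α P ht χ ∧ ∀ g, busemann α x xs g = (χ g).toAdd := by
  have : Nonempty V := ⟨x⟩
  obtain ⟨ht, hend, hht⟩ := hxs.exists_isRootedAtEnd hΓ x
  obtain ⟨χ, hχ⟩ := hend.exists_fixesEnd (hξ.map_parent hΓ)
  exact ⟨_, ht, χ, hχ, hχ.busemann_eq hht⟩

end ConfTree

theorem mainTheorem10_general :
    (∀ {G : Type*} [Group G] (H Z : Subgroup G) [H.Normal] (_ : H.IsComplement' Z)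
        (ρ : Z →* Multiplicative ℝ), ρ ≠ 1 → IsDiscrete ρ →
        ∀ Q : Subgroup G, IsConfining H Z ρ (Q : Set G) →
        (∃ a : Z, IsMinimalPositive ρ a) ∧
        ∃ K : Subgroup G, (K : Set G) = (Q : Set G) * (kerIn ρ : Set G) ∧
          ∀ a : Z, IsMinimalPositive ρ a →
            IsAscendingHNN K (a : G) ∧ (bassSerre K (a : G)).IsTree ∧
            ∀ e : Z, 0 < (ρ e).toAdd →
              IsRepresentedBy ((Q : Set G) ∪ slab ρ (ρ e).toAdd) (bassSerreAction K (a : G))) ∧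
    (∀ {G : Type*} [Group G] (H Z : Subgroup G) [H.Normal] [IsMulCommutative Z] (_ : H ⊔ Z = ⊤)
        {V : Type*} (X : SimpleGraph V) (_ : X.IsTree) (α : G →* (X ≃g X)), IsCobounded α →
        ∀ (ξ : Boundary X) (x : V) (xs : ℕ → V), FixesPoint α ξ → ConvergesTo xs ξ →
        (∀ h ∈ H, busemann α x xs h = 0) →
        ∃ ρ : Z →* Multiplicative ℝ, ρ ≠ 1 ∧
          (∀ h ∈ H, ∀ z : Z, busemann α x xs (h * z) = (ρ z).toAdd) ∧
          IsDiscrete ρ ∧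
          ∃ w : V, IsConfining H Z ρ (vertexStabilizer α H w : Set G) ∧
            (IsOrientedLineal α → vertexStabilizer α H w = H) ∧
            (IsQuasiParabolic α → IsStrictlyConfining H Z ρ (vertexStabilizer α H w : Set G)) ∧
            ∀ e : Z, 0 < (ρ e).toAdd →
              IsRepresentedBy ((vertexStabilizer α H w : Set G) ∪ slab ρ (ρ e).toAdd) α ∧
              IsEquivariantlyQuasiIsometric
                (cayleyAction ((vertexStabilizer α H w : Set G) ∪ slab ρ (ρ e).toAdd)) α) := by
  refine ⟨fun H Z _ hHZ ρ hne hd Q hQ => ⟨exists_isMinimalPositive hne hd, Q ⊔ kerIn ρ,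
    hQ.coe_sup_kerIn, fun a ha => hQ.isAscendingHNN_isTree_isRepresentedBy hHZ ha⟩, ?_⟩
  intro G _ H Z _ _ hHZ V X hX α hα ξ x xs hξ hxs hvanish
  obtain ⟨P, ht, χ, hend, hbusemann⟩ := hξ.exists_fixesEnd hxs hX x
  have hH : H ≤ χ.ker := fun h hh => Multiplicative.toAdd.injective
    (Int.cast_injective (α := ℝ) (by simpa using (hbusemann h).symm.trans (hvanish h hh)))
  obtain ⟨b, hb, hχb⟩ := hend.exists_pos hα hH hHZ
  obtain ⟨w, hw⟩ := hend.exists_isAxial hb hχb x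
  set ρ : Z →* Multiplicative ℝ :=
    (AddMonoidHom.toMultiplicative (Int.castAddHom ℝ)).comp (χ.comp Z.subtype)
  have hρ (z : Z) : (ρ z).toAdd = 1 * (χ z).toAdd := (one_mul _).symm
  have hρb : 0 < (ρ ⟨b, hb⟩).toAdd := Int.cast_pos.2 hχb
  refine ⟨ρ, fun h => by simp [h] at hρb, fun h hh z => ?_,
    isDiscrete_of_toAdd_eq_intCast fun _ => rfl, w,
    hw.isConfining_vertexStabilizer hH one_pos hρ hρb,
    fun hlin => hw.vertexStabilizer_eq_of_isOrientedLineal hX hlin hH hb hχb,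
    hw.isStrictlyConfining_vertexStabilizer hH hHZ one_pos hρ hρb,
    fun e he => hw.isRepresentedBy_union_slab hH hHZ hα one_pos hρ he⟩
  rw [hbusemann, map_mul, hH hh, one_mul]
  rfl

theorem mainTheorem10 :
    -- confining subgroups yield trees
    (∀ {G : Type*} [Group G] (H Z : Subgroup G) [H.Normal] (_ : H.IsComplement' Z)
        (n : ℕ) (_ : Z ≃* Multiplicative (Fin n → ℤ))
        (ρ : Z →* Multiplicative ℝ), ρ ≠ 1 → IsDiscrete ρ →
        ∀ Q : Subgroup G, IsConfining H Z ρ (Q : Set G) →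
        (∃ a : Z, IsMinimalPositive ρ a) ∧
        ∃ K : Subgroup G, (K : Set G) = (Q : Set G) * (kerIn ρ : Set G) ∧
          ∀ a : Z, IsMinimalPositive ρ a →
            IsAscendingHNN K (a : G) ∧ (bassSerre K (a : G)).IsTree ∧
            ∀ C : ℝ, IsAdmissible ρ C →
              IsRepresentedBy ((Q : Set G) ∪ slab ρ C) (bassSerreAction K (a : G))) ∧
    -- trees yield confining subgroups
    (∀ {G : Type*} [Group G] (H Z : Subgroup G) [H.Normal] (_ : H.IsComplement' Z)
        (n : ℕ) (_ : Z ≃* Multiplicative (Fin n → ℤ))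
        {V : Type*} (X : SimpleGraph V) (_ : X.IsTree) (α : G →* (X ≃g X)),
        IsCobounded α → (IsOrientedLineal α ∨ IsQuasiParabolic α) →
        ∀ (ξ : Boundary X) (x : V) (xs : ℕ → V), FixesPoint α ξ → ConvergesTo xs ξ →
        (∀ h ∈ H, busemann α x xs h = 0) →
        ∃ ρ : Z →* Multiplicative ℝ, ρ ≠ 1 ∧
          (∀ h ∈ H, ∀ z : Z, busemann α x xs (h * z) = (ρ z).toAdd) ∧
          IsDiscrete ρ ∧
          ∃ w : V, IsConfining H Z ρ (vertexStabilizer α H w : Set G) ∧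
            (IsOrientedLineal α → vertexStabilizer α H w = H) ∧
            (IsQuasiParabolic α → IsStrictlyConfining H Z ρ (vertexStabilizer α H w : Set G)) ∧
            ∀ C : ℝ, IsAdmissible ρ C →
              IsRepresentedBy ((vertexStabilizer α H w : Set G) ∪ slab ρ C) α ∧
              IsEquivariantlyQuasiIsometric
                (cayleyAction ((vertexStabilizer α H w : Set G) ∪ slab ρ C)) α) := by
  obtain ⟨of_confining, of_tree⟩ := mainTheorem10_general
  constructor
  · intro G _ H Z _ hHZ n _ ρ hne hd Q hQ
    obtain ⟨hmin, K, hK, hrep⟩ := of_confining H Z hHZ ρ hne hd Q hQ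
    refine ⟨hmin, K, hK, fun a ha => ?_⟩
    obtain ⟨hHNN, htree, hrep⟩ := hrep a ha
    exact ⟨hHNN, htree, fun _ ⟨hC, _, e, he⟩ => he ▸ hrep e (he ▸ hC)⟩
  · intro G _ H Z _ hHZ n iso V X hX α hα _ ξ x xs hξ hxs hH
    have : IsMulCommutative Z := .of_comm fun y z => iso.injective (by
      rw [map_mul, map_mul, mul_comm])
    obtain ⟨ρ, hne, hbusemann, hd, w, hconf, hlin, hqp, hrep⟩ :=
      of_tree H Z hHZ.sup_eq_top X hX α hα ξ x xs hξ hxs hH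
    exact ⟨ρ, hne, hbusemann, hd, w, hconf, hlin, hqp,
      fun _ ⟨hC, _, e, he⟩ => he ▸ hrep e (he ▸ hC)⟩
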